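/- Let $F_2$ be the free group with basis $\{a,b\}$. For $w\in F_2$ let $\|w\|$ be its cyclic length, i.e. the length of a cyclically reduced word conjugate to $w$. Call $u,v\in F_2$ \emph{boundedly translation equivalent} if there is $C>0$ such that $\frac1C\|\phi(v)\|\le\|\phi(u)\|\le C\|\phi(v)\|$ for every automorphism $\phi$ of $F_2$ (for nontrivial $u,v$ this says that the ratio $\|\phi(u)\|/\|\phi(v)\|$ always lies in $[1/C,C]$; the trivial element is equivalent only to itself). Let $\sigma,\tau$ be the automorphisms of $F_2$ with $\sigma(a)=ab$, $\sigma(b)=b$, $\tau(a)=a$, $\tau(b)=ba$. A chain of type (C1) is a composition $\tau^{m_r}\sigma^{l_r}\cdots\tau^{m_1}\sigma^{l_1}$, and a chain of type (C2) is a composition $\tau^{-m_r}\sigma^{-l_r}\cdots\tau^{-m_1}\sigma^{-l_1}$, with $r\ge 0$ and all $m_i,l_i\ge0$; its length is $\sum_i(m_i+l_i)$. For $u\in F_2$ let $\Omega_1$ (resp. $\Omega_2$) be the set of all chains of type (C1) (resp. (C2)) of length at most $2\|u\|+5$, and put $k=\|u\|+1$. Consider the following condition on $u,v$ with $\|u\|\ge\|v\|$: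 $(\ast)$ for every $\psi_1\in\Omega_1$ and each $\alpha\in\{\sigma,\tau\}$, $$\|\alpha^{k+1}\psi_1(u)\|=\|\alpha^{k}\psi_1(u)\|\iff\|\alpha^{k+1}\psi_1(v)\|=\|\alpha^{k}\psi_1(v)\|,$$ and for every $\psi_2\in\Omega_2$ and each $\alpha\in\{\sigma,\tau\}$, $$\|\alpha^{-k-1}\psi_2(u)\|=\|\alpha^{-k}\psi_2(u)\|\iff\|\alpha^{-k-1}\psi_2(v)\|=\|\alpha^{-k}\psi_2(v)\|.$$ Theorem. (1) If $u,v\in F_2$ with $\|u\|\ge\|v\|$ are boundedly translation equivalent, then $(\ast)$ holds. (2) Conversely, if $u,v\in F_2$ are nontrivial with $\|u\|\ge\|v\|$ and $(\ast)$ holds, then $u$ and $v$ are boundedly translation equivalent. (3) For each $n$ there are only finitely many chains of type (C1) or (C2) of length at most $n$ (so $\Omega_1$ and $\Omega_2$ are finite), and there is an algorithm which, given two words in $a^{\pm1},b^{\pm1}$, decides whether the elements of $F_2$ they represent are boundedly translation equivalent. -/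

import Mathlib

/-- The free group `F₂`; its basis is `a = FreeGroup.of 0`, `b = FreeGroup.of 1`. -/
abbrev F2 : Type := FreeGroup (Fin 2)

namespace F2

/-- The basis element `a`. -/
def a : F2 := FreeGroup.of 0

/-- The basis element `b`. -/
def b : F2 := FreeGroup.of 1

/-- The cyclic length `‖w‖`: the length of the cyclically reduced word obtained from the reduced
word of `w` by cancelling first and last letters as long as possible. -/
def cycLen (w : F2) : ℕ :=
  (FreeGroup.reduceCyclically w.toWord).length

/-- The Whitehead automorphism `σ = ({a}, b)`: `a ↦ a b`, `b ↦ b`. -/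
def sigma : MulAut F2 :=
  MonoidHom.toMulEquiv (FreeGroup.lift ![a * b, b]) (FreeGroup.lift ![a * b⁻¹, b])
    (by ext i; fin_cases i <;> simp [a, b])
    (by ext i; fin_cases i <;> simp [a, b])

/-- The Whitehead automorphism `τ = ({b}, a)`: `a ↦ a`, `b ↦ b a`. -/
def tau : MulAut F2 :=
  MonoidHom.toMulEquiv (FreeGroup.lift ![a, b * a]) (FreeGroup.lift ![a, b * a⁻¹])
    (by ext i; fin_cases i <;> simp [a, b])
    (by ext i; fin_cases i <;> simp [a, b])

/-- For the list `[(l_k, m_k), …, (l_1, m_1)]`, the composition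
`t ^ m_k ∘ s ^ l_k ∘ ⋯ ∘ t ^ m_1 ∘ s ^ l_1`. -/
def chain (s t : MulAut F2) (L : List (ℕ × ℕ)) : MulAut F2 :=
  (L.map fun p => t ^ p.2 * s ^ p.1).prod

/-- The length `∑ (m_i + l_i)` of a chain. -/
def chainLength (L : List (ℕ × ℕ)) : ℕ :=
  (L.map fun p => p.2 + p.1).sum

/-- Chains of type (C1), `τ ^ m_k σ ^ l_k ⋯ τ ^ m_1 σ ^ l_1`, of length at most `n`. -/
def chainsC1 (n : ℕ) : Set (MulAut F2) :=
  {ψ | ∃ L : List (ℕ × ℕ), chainLength L ≤ n ∧ ψ = chain sigma tau L}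

/-- Chains of type (C2), `τ ^ (-m_k) σ ^ (-l_k) ⋯ τ ^ (-m_1) σ ^ (-l_1)`, of length at
most `n`. -/
def chainsC2 (n : ℕ) : Set (MulAut F2) :=
  {ψ | ∃ L : List (ℕ × ℕ), chainLength L ≤ n ∧ ψ = chain sigma⁻¹ tau⁻¹ L}

/-- Bounded translation equivalence: for some `C > 0`, `1 / C ≤ ‖φ u‖ / ‖φ v‖ ≤ C` for all
automorphisms `φ`. The denominator is cleared, so that the definition also makes sense for the
trivial element (which is then equivalent to itself only); see
`boundedlyTranslationEquivalent_iff_ratio` for the quotient form. -/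
def BoundedlyTranslationEquivalent (u v : F2) : Prop :=
  ∃ C : ℝ, 0 < C ∧ ∀ φ : MulAut F2,
    1 / C * (cycLen (φ v) : ℝ) ≤ (cycLen (φ u) : ℝ) ∧
      (cycLen (φ u) : ℝ) ≤ C * (cycLen (φ v) : ℝ)

/-- For `α ∈ {s, t}` and every `ψ ∈ Ω`, the equality `‖α ^ (k + 1) ψ(u)‖ = ‖α ^ k ψ(u)‖` holds
if and only if `‖α ^ (k + 1) ψ(v)‖ = ‖α ^ k ψ(v)‖` does. -/
def SameStability (s t : MulAut F2) (Ω : Set (MulAut F2)) (k : ℕ) (u v : F2) : Prop :=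
  ∀ ψ ∈ Ω,
    (cycLen ((s ^ (k + 1)) (ψ u)) = cycLen ((s ^ k) (ψ u)) ↔
      cycLen ((s ^ (k + 1)) (ψ v)) = cycLen ((s ^ k) (ψ v))) ∧
    (cycLen ((t ^ (k + 1)) (ψ u)) = cycLen ((t ^ k) (ψ u)) ↔
      cycLen ((t ^ (k + 1)) (ψ v)) = cycLen ((t ^ k) (ψ v)))

/-- The finite criterion for a pair `u, v` with `‖v‖ ≤ ‖u‖`: with `k = ‖u‖ + 1`, the equivalences
for `σ, τ` on all (C1) chains, and those for `σ⁻¹, τ⁻¹` on all (C2) chains, of length at most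
`2 ‖u‖ + 5`. -/
def ChainCriterion (u v : F2) : Prop :=
  SameStability sigma tau (chainsC1 (2 * cycLen u + 5)) (cycLen u + 1) u v ∧
    SameStability sigma⁻¹ tau⁻¹ (chainsC2 (2 * cycLen u + 5)) (cycLen u + 1) u v

theorem cycLen_pos {w : F2} (hw : w ≠ 1) : 0 < cycLen w := by
  rw [cycLen, List.length_pos_iff]
  intro h
  apply hw
  have h1 := FreeGroup.reduceCyclically.conj_conjugator_reduceCyclically w.toWord
  rw [h, List.append_nil] at h1
  rw [← FreeGroup.mk_toWord (x := w), ← h1, ← FreeGroup.mul_mk, ← FreeGroup.inv_mk,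
    mul_inv_cancel]

theorem boundedlyTranslationEquivalent_iff_ratio {u v : F2} (hv : v ≠ 1) :
    BoundedlyTranslationEquivalent u v ↔
      ∃ C : ℝ, 0 < C ∧ ∀ φ : MulAut F2,
        1 / C ≤ (cycLen (φ u) : ℝ) / (cycLen (φ v) : ℝ) ∧
          (cycLen (φ u) : ℝ) / (cycLen (φ v) : ℝ) ≤ C := by
  have hpos : ∀ φ : MulAut F2, (0 : ℝ) < cycLen (φ v) := fun φ => by
    exact_mod_cast cycLen_pos (by simpa using hv)
  simp only [BoundedlyTranslationEquivalent, le_div_iff₀ (hpos _), div_le_iff₀ (hpos _)]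

end F2

/-! As far as cyclic lengths are concerned, every automorphism of F₂ is a positive chain in σ and τ,
possibly preceded by the flip b ↦ b⁻¹ (`actsAsChain`). Inner automorphisms and signed permutations
of the basis preserve cyclic length, Nielsen reduction brings any automorphism down to these, and a
few identities push the flip to the right. The flip also turns (C2) chains into (C1) chains
(`cycLen_wordProd_inv`). So it suffices to compare u with v, and their flips, along positive chains.

Cut a cyclic word into maximal segments of constant sign, P₁Q₁⁻¹⋯PₜQₜ⁻¹. Since σ(S) ends in b for
every nonempty positive S, one b of each of the 2t segments cancels, and no other letter does. The
length therefore grows by the number of letters a^±, minus 2t. The structure changes only when a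
segment equal to b vanishes and its neighbours merge. The total length of the segments that are
powers of one letter decreases at each step until the data are tame, so more than ‖u‖ steps suffice
(`HasData.act_tame`).

For tame data, the growth rates ("slopes") under powers of σ and τ evolve by adding one to the
other, by the same rule for every word (`SegData.Tame.step`), and the length lies between the sum of
the slopes and that sum plus 4t. Hence if the slopes of u vanish wherever those of v do, u stays
bounded by a multiple of v along all further chains (`dominated_of_tame`). For tame data the
stability condition says exactly that a slope is zero, and only finitely many initial chains need
testing. Conversely, if high powers leave the length of v unchanged but not that of u, the ratio is
unbounded (`ChainDominated.stable`). -/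

namespace F2

/-! ### Cyclic length: conjugation invariance and symmetries -/

theorem norm_pow (w : F2) {n : ℕ} (hn : n ≠ 0) :
    (w ^ n).norm = n * cycLen w + 2 * (FreeGroup.reduceCyclically.conjugator w.toWord).length := by
  rw [FreeGroup.norm, FreeGroup.toWord_pow,
    FreeGroup.reduceCyclically.reduce_flatten_replicate FreeGroup.isReduced_toWord, if_neg hn]
  simp [cycLen]
  ring

/-- The conjugating prefix contributes the same amount to the norms of w and w², so it drops out.
Cyclic length is thereby expressed through norms alone, which isometries and algorithms handle
directly. -/
theorem cycLen_eq_norm_sub (w : F2) : cycLen w = (w * w).norm - w.norm := by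
  have h1 := norm_pow w one_ne_zero
  have h2 := norm_pow w two_ne_zero
  rw [pow_one] at h1
  rw [pow_two] at h2
  omega

/-- Norms of the powers of w grow at rate ‖w‖, and conjugation by g changes each of them by at most
2|g|. The exponent N is chosen to outweigh this and the constant 2m in `norm_pow`. -/
theorem cycLen_conj_le (g w : F2) : cycLen (g * w * g⁻¹) ≤ cycLen w := by
  by_contra! h
  set m := (FreeGroup.reduceCyclically.conjugator w.toWord).length
  set N := 2 * g.norm + 2 * m + 1 with hN
  have h1 := norm_pow w (n := N) (by omega)
  have h2 := norm_pow (g * w * g⁻¹) (n := N) (by omega)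
  rw [conj_pow] at h2
  have h3 := FreeGroup.norm_mul_le (g * w ^ N) g⁻¹
  have h4 := FreeGroup.norm_mul_le g (w ^ N)
  rw [FreeGroup.norm_inv_eq] at h3
  have h5 : N * (cycLen w + 1) ≤ N * cycLen (g * w * g⁻¹) := Nat.mul_le_mul_left _ h
  rw [mul_add, mul_one] at h5
  omega

theorem cycLen_conj (g w : F2) : cycLen (g * w * g⁻¹) = cycLen w := by
  refine le_antisymm (cycLen_conj_le g w) ?_
  have := cycLen_conj_le g⁻¹ (g * w * g⁻¹)
  rwa [show g⁻¹ * (g * w * g⁻¹) * g⁻¹⁻¹ = w by group] at this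

theorem cycLen_congr {v w : F2} (h : IsConj v w) : cycLen v = cycLen w := by
  obtain ⟨g, rfl⟩ := isConj_iff.1 h
  rw [cycLen_conj]

theorem cycLen_inv (w : F2) : cycLen w⁻¹ = cycLen w := by
  rw [cycLen_eq_norm_sub, cycLen_eq_norm_sub, ← mul_inv_rev, FreeGroup.norm_inv_eq,
    FreeGroup.norm_inv_eq]

theorem cycLen_one : cycLen 1 = 0 := by
  simp [cycLen_eq_norm_sub]

theorem cycLen_eq_zero {w : F2} : cycLen w = 0 ↔ w = 1 := by
  refine ⟨fun h => ?_, fun h => h ▸ cycLen_one⟩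
  by_contra hw
  exact (cycLen_pos hw).ne' h

theorem cycLen_mk_of_isCyclicallyReduced {L : List (Fin 2 × Bool)}
    (h : FreeGroup.IsCyclicallyReduced L) : cycLen (FreeGroup.mk L) = L.length := by
  have key : ∀ n, (FreeGroup.mk L ^ n).norm = n * L.length := by
    intro n
    rw [FreeGroup.norm, FreeGroup.pow_mk, FreeGroup.toWord_mk,
      (h.flatten_replicate n).isReduced.reduce_eq]
    simp
  have h1 := key 1
  have h2 := key 2
  rw [pow_one] at h1
  rw [pow_two] at h2
  rw [cycLen_eq_norm_sub]
  omega

theorem norm_map_le (φ : F2 →* F2) (h : ∀ i, (φ (FreeGroup.of i)).norm ≤ 1) (w : F2) :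
    (φ w).norm ≤ w.norm := by
  have key : ∀ L : List (Fin 2 × Bool), (φ (FreeGroup.mk L)).norm ≤ L.length := by
    intro L
    induction L with
    | nil => simp [← FreeGroup.one_eq_mk]
    | cons x L ih =>
      rw [show FreeGroup.mk (x :: L) = FreeGroup.mk [x] * FreeGroup.mk L by
        rw [FreeGroup.mul_mk, List.singleton_append], map_mul]
      have hx : (φ (FreeGroup.mk [x])).norm ≤ 1 := by
        obtain ⟨i, b⟩ := x
        cases b
        · rw [show FreeGroup.mk [(i, false)] = (FreeGroup.of i)⁻¹ from rfl, map_inv,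
            FreeGroup.norm_inv_eq]
          exact h i
        · exact h i
      have := FreeGroup.norm_mul_le (φ (FreeGroup.mk [x])) (φ (FreeGroup.mk L))
      rw [List.length_cons]
      omega
  have := key w.toWord
  rwa [FreeGroup.mk_toWord] at this

theorem cycLen_of_involutive (φ : MulAut F2) (h : ∀ i, (φ (FreeGroup.of i)).norm ≤ 1)
    (hφ : φ * φ = 1) (w : F2) : cycLen (φ w) = cycLen w := by
  have hn : ∀ x, (φ x).norm = x.norm := by
    intro x
    refine le_antisymm (norm_map_le φ.toMonoidHom h x) ?_
    have h1 := norm_map_le φ.toMonoidHom h (φ x)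
    have h2 : φ (φ x) = x := by rw [← MulAut.mul_apply, hφ, MulAut.one_apply]
    change (φ (φ x)).norm ≤ _ at h1
    rwa [h2] at h1
  rw [cycLen_eq_norm_sub, cycLen_eq_norm_sub, ← map_mul, hn, hn]

/-- The automorphism exchanging `a` and `b`. -/
def swapAut : MulAut F2 :=
  MonoidHom.toMulEquiv (FreeGroup.lift ![b, a]) (FreeGroup.lift ![b, a])
    (by ext i; fin_cases i <;> simp [a, b])
    (by ext i; fin_cases i <;> simp [a, b])

/-- The automorphism `a ↦ a`, `b ↦ b⁻¹`. -/
def flipAut : MulAut F2 :=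
  MonoidHom.toMulEquiv (FreeGroup.lift ![a, b⁻¹]) (FreeGroup.lift ![a, b⁻¹])
    (by ext i; fin_cases i <;> simp [a, b])
    (by ext i; fin_cases i <;> simp [a, b])

@[simp] theorem sigma_a : sigma a = a * b := by simp [sigma, a]
@[simp] theorem sigma_b : sigma b = b := by simp [sigma, b]
@[simp] theorem tau_a : tau a = a := by simp [tau, a]
@[simp] theorem tau_b : tau b = b * a := by simp [tau, b]
@[simp] theorem swapAut_a : swapAut a = b := by simp [swapAut, a]
@[simp] theorem swapAut_b : swapAut b = a := by simp [swapAut, b]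
@[simp] theorem flipAut_a : flipAut a = a := by simp [flipAut, a]
@[simp] theorem flipAut_b : flipAut b = b⁻¹ := by simp [flipAut, b]

theorem aut_ext {φ ψ : MulAut F2} (ha : φ a = ψ a) (hb : φ b = ψ b) : φ = ψ := by
  have : φ.toMonoidHom = ψ.toMonoidHom := by
    ext i
    fin_cases i
    · exact ha
    · exact hb
  ext x
  exact DFunLike.congr_fun this x

theorem swapAut_mul_self : swapAut * swapAut = 1 := by
  apply aut_ext <;> simp

theorem flipAut_mul_self : flipAut * flipAut = 1 := by
  apply aut_ext <;> simp

theorem swapAut_sigma_swapAut : swapAut * sigma * swapAut = tau := by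
  apply aut_ext <;> simp

theorem cycLen_swapAut (w : F2) : cycLen (swapAut w) = cycLen w := by
  refine cycLen_of_involutive _ (fun i => ?_) swapAut_mul_self w
  fin_cases i <;> simp [swapAut, a, b]

theorem cycLen_flipAut (w : F2) : cycLen (flipAut w) = cycLen w := by
  refine cycLen_of_involutive _ (fun i => ?_) flipAut_mul_self w
  fin_cases i <;> simp [flipAut, a, b]

/-! ### Positive words and their images under σ -/

/-- The element represented by a positive word. -/
def pos (S : List (Fin 2)) : F2 := FreeGroup.mk (S.map fun i => (i, true))

@[simp] theorem pos_nil : pos [] = 1 := rfl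

theorem pos_append (S T : List (Fin 2)) : pos (S ++ T) = pos S * pos T := by
  simp [pos, FreeGroup.mul_mk]

theorem pos_cons (i : Fin 2) (S : List (Fin 2)) : pos (i :: S) = FreeGroup.of i * pos S := by
  rw [← List.singleton_append, pos_append]
  rfl

theorem eq_zero_or_one (x : Fin 2) : x = 0 ∨ x = 1 := by revert x; decide

/-- The substitution `a ↦ b a`, `b ↦ b`, which is `σ` conjugated by `b`. -/
def shiftSubst (x : Fin 2) : List (Fin 2) := if x = 0 then [1, 0] else [1]

/-- For a nonempty positive word `S`, `sigmaSeg S` is the positive word `σ(S) b⁻¹`. -/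
def sigmaSeg : List (Fin 2) → List (Fin 2)
  | [] => []
  | x :: S => (if x = 0 then [0] else []) ++ S.flatMap shiftSubst

/-- Total length of a word all of whose letters are `i`, and `0` for all other words. -/
def pureLen (i : Fin 2) (S : List (Fin 2)) : ℕ := if ∀ x ∈ S, x = i then S.length else 0

/-- `1` for a nonempty word all of whose letters are `i`, and `0` for all other words. -/
def pureNum (i : Fin 2) (S : List (Fin 2)) : ℕ := if S ≠ [] ∧ ∀ x ∈ S, x = i then 1 else 0

/-- `1` for the empty word, `0` for all others. -/
def emptyNum (S : List (Fin 2)) : ℕ := if S = [] then 1 else 0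

theorem pos_flatMap_aux (S : List (Fin 2)) :
    pos (S.flatMap shiftSubst) = b * sigma (pos S) * b⁻¹ := by
  induction S with
  | nil => simp
  | cons x S ih =>
    rw [List.flatMap_cons, pos_append, ih, pos_cons, map_mul]
    have := eq_zero_or_one x
    rcases this with rfl | rfl
    · have h : sigma (FreeGroup.of 0) = a * b := sigma_a
      rw [h]
      simp only [shiftSubst, if_true, pos_cons, pos_nil]
      change b * (a * 1) * _ = _
      group
    · have h : sigma (FreeGroup.of 1) = b := sigma_b
      rw [h]
      simp only [shiftSubst, one_ne_zero, if_false, pos_cons, pos_nil]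
      change b * 1 * _ = _
      group

theorem sigma_pos {S : List (Fin 2)} (hS : S ≠ []) : sigma (pos S) = pos (sigmaSeg S) * b := by
  obtain _ | ⟨x, S⟩ := S
  · exact absurd rfl hS
  rw [sigmaSeg, pos_append, pos_flatMap_aux, pos_cons, map_mul]
  have := eq_zero_or_one x
  rcases this with rfl | rfl
  · have h : sigma (FreeGroup.of 0) = a * b := sigma_a
    rw [h]
    simp only [if_true, pos_cons, pos_nil]
    change _ = a * 1 * _ * b
    group
  · have h : sigma (FreeGroup.of 1) = b := sigma_b
    rw [h]
    simp only [one_ne_zero, if_false, pos_nil]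
    group

/-- The default letter is b because the only nonempty word sent to the empty one is b itself. With
this convention σ keeps end letters, so the absence of cancellation survives even when a segment
vanishes. -/
theorem headD_sigmaSeg (S : List (Fin 2)) : (sigmaSeg S).headD 1 = S.headD 1 := by
  obtain _ | ⟨x, _ | ⟨y, S⟩⟩ := S
  · rfl
  · revert x; decide
  · have hx : x = 0 ∨ x = 1 := eq_zero_or_one x
    have hy : y = 0 ∨ y = 1 := eq_zero_or_one y
    rcases hx with rfl | rfl <;> rcases hy with rfl | rfl <;> simp [sigmaSeg, shiftSubst]

theorem getLastD_sigmaSeg (S : List (Fin 2)) : (sigmaSeg S).getLastD 1 = S.getLastD 1 := by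
  obtain rfl | ⟨S, y, rfl⟩ := S.eq_nil_or_concat'
  · rfl
  · have hy : y = 0 ∨ y = 1 := eq_zero_or_one y
    obtain _ | ⟨x, S⟩ := S
    · revert y; decide
    · rcases hy with rfl | rfl <;> simp [sigmaSeg, shiftSubst, List.getLastD_eq_getLast?,
        List.getLast?_append, List.getLast?_cons]

theorem count_zero_sigmaSeg (S : List (Fin 2)) : (sigmaSeg S).count 0 = S.count 0 := by
  have key : ∀ S : List (Fin 2),
      (S.flatMap shiftSubst).count 0 = S.count 0 := by
    intro S
    induction S with
    | nil => rfl
    | cons x S ih =>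
      rw [List.flatMap_cons, List.count_append, ih, List.count_cons]
      have hx : x = 0 ∨ x = 1 := eq_zero_or_one x
      rcases hx with rfl | rfl <;> simp [shiftSubst, add_comm]
  obtain _ | ⟨x, S⟩ := S
  · rfl
  · rw [sigmaSeg, List.count_append, key, List.count_cons]
    have hx : x = 0 ∨ x = 1 := eq_zero_or_one x
    rcases hx with rfl | rfl <;> simp [add_comm]

theorem count_add_count (S : List (Fin 2)) : S.count 0 + S.count 1 = S.length := by
  induction S with
  | nil => rfl
  | cons x S ih =>
    rw [List.count_cons, List.count_cons, List.length_cons]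
    have hx : x = 0 ∨ x = 1 := eq_zero_or_one x
    rcases hx with rfl | rfl <;> simp <;> omega

theorem count_one_sigmaSeg {S : List (Fin 2)} (hS : S ≠ []) :
    (sigmaSeg S).count 1 + 1 = S.count 0 + S.count 1 := by
  have key : ∀ S : List (Fin 2),
      (S.flatMap shiftSubst).count 1 = S.length := by
    intro S
    induction S with
    | nil => rfl
    | cons x S ih =>
      rw [List.flatMap_cons, List.count_append, ih, List.length_cons]
      have hx : x = 0 ∨ x = 1 := eq_zero_or_one x
      rcases hx with rfl | rfl <;> simp [shiftSubst, add_comm]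
  obtain _ | ⟨x, S⟩ := S
  · exact absurd rfl hS
  · rw [sigmaSeg, List.count_append, key, count_add_count, List.length_cons]
    have hx : x = 0 ∨ x = 1 := eq_zero_or_one x
    rcases hx with rfl | rfl <;> simp

theorem sigmaSeg_eq_replicate {S : List (Fin 2)} (h : ∀ x ∈ S, x = 1) :
    sigmaSeg S = List.replicate (S.length - 1) 1 := by
  rw [List.eq_replicate_of_mem h]
  obtain _ | ⟨x, S⟩ := S
  · rfl
  · simp [sigmaSeg, List.replicate_succ, shiftSubst, List.flatMap_replicate]

theorem zero_mem_sigmaSeg {S : List (Fin 2)} (h : 0 ∈ S) : 0 ∈ sigmaSeg S := by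
  rw [← List.count_pos_iff] at h ⊢
  rwa [count_zero_sigmaSeg]

theorem forall_eq_one_iff {S : List (Fin 2)} : (∀ x ∈ S, x = 1) ↔ 0 ∉ S := by
  refine ⟨fun h h0 => absurd (h 0 h0) (by decide), fun h x hx => ?_⟩
  have hx' : x = 0 ∨ x = 1 := eq_zero_or_one x
  rcases hx' with rfl | rfl
  · exact absurd hx h
  · rfl

theorem forall_eq_zero_iff {S : List (Fin 2)} : (∀ x ∈ S, x = 0) ↔ 1 ∉ S := by
  refine ⟨fun h h0 => absurd (h 1 h0) (by decide), fun h x hx => ?_⟩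
  have hx' : x = 0 ∨ x = 1 := eq_zero_or_one x
  rcases hx' with rfl | rfl
  · rfl
  · exact absurd hx h

/-- A power of b loses one letter and vanishes only if it was b; any other word keeps its letters a.
The last inequality says that a power of b either vanishes or had length at least two. -/
theorem sigmaSeg_pure_one {S : List (Fin 2)} (hS : S ≠ []) :
    pureLen 1 (sigmaSeg S) + pureNum 1 S = pureLen 1 S ∧ emptyNum (sigmaSeg S) ≤ pureNum 1 S ∧
      2 * pureNum 1 S ≤ pureLen 1 S + emptyNum (sigmaSeg S) := by
  have hpos := List.length_pos_iff.2 hS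
  by_cases h : ∀ x ∈ S, x = 1
  · rw [sigmaSeg_eq_replicate h]
    have h1 : pureNum 1 S = 1 := if_pos ⟨hS, h⟩
    have h2 : pureLen 1 S = S.length := if_pos h
    have h3 : pureLen 1 (List.replicate (S.length - 1) 1) = S.length - 1 := by
      rw [pureLen, if_pos fun x hx => List.eq_of_mem_replicate hx, List.length_replicate]
    have h4 : emptyNum (List.replicate (S.length - 1) (1 : Fin 2)) =
        if S.length - 1 = 0 then 1 else 0 := by
      simp [emptyNum]
    rw [h1, h2, h3, h4]
    split_ifs <;> omega
  · have h0 : 0 ∈ S := by rwa [forall_eq_one_iff, not_not] at h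
    have h0' := zero_mem_sigmaSeg h0
    have h' : ¬ ∀ x ∈ sigmaSeg S, x = 1 := by rwa [forall_eq_one_iff, not_not]
    have h1 : pureNum 1 S = 0 := if_neg fun H => h H.2
    have h2 : pureLen 1 S = 0 := if_neg h
    have h3 : pureLen 1 (sigmaSeg S) = 0 := if_neg h'
    have h4 : emptyNum (sigmaSeg S) = 0 := if_neg (List.ne_nil_of_mem h0')
    omega

/-- Every letter after the first contributes a b to the image, so a nonempty power of a can only
arise from the single letter a. -/
theorem sigmaSeg_pure_zero {S : List (Fin 2)} (hS : S ≠ []) :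
    pureLen 0 (sigmaSeg S) ≤ pureNum 0 S ∧ pureNum 0 (sigmaSeg S) = pureLen 0 (sigmaSeg S) ∧
      2 * pureNum 0 S ≤ pureLen 0 S + pureLen 0 (sigmaSeg S) := by
  obtain _ | ⟨x, _ | ⟨y, S⟩⟩ := S
  · exact absurd rfl hS
  · revert x
    decide
  · have h1 : 1 ∈ sigmaSeg (x :: y :: S) := by
      have hy : y = 0 ∨ y = 1 := eq_zero_or_one y
      rcases hy with rfl | rfl <;> simp [sigmaSeg, shiftSubst]
    have h : ¬ ∀ z ∈ sigmaSeg (x :: y :: S), z = 0 := by rwa [forall_eq_zero_iff, not_not]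
    have h2 : pureLen 0 (sigmaSeg (x :: y :: S)) = 0 := if_neg h
    have h3 : pureNum 0 (sigmaSeg (x :: y :: S)) = 0 := if_neg fun H => h H.2
    have h4 : 2 * pureNum 0 (x :: y :: S) ≤ pureLen 0 (x :: y :: S) := by
      unfold pureNum pureLen
      split_ifs with h5 h6 h6
      · simp
      · exact absurd h5.2 h6
      · simp
      · simp
    omega

theorem pureNum_le_pureLen (i : Fin 2) (S : List (Fin 2)) : pureNum i S ≤ pureLen i S := by
  unfold pureNum pureLen
  split_ifs with h1 h2
  · have := List.length_pos_iff.2 h1.1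
    omega
  · exact absurd h1.2 h2
  · exact Nat.zero_le _
  · exact Nat.zero_le _

theorem pureLen_eq_zero {i : Fin 2} {S : List (Fin 2)} (h : pureNum i S = 0) : pureLen i S = 0 := by
  by_cases hS : S = []
  · rw [hS]
    rfl
  · refine if_neg fun h2 => ?_
    rw [pureNum, if_pos ⟨hS, h2⟩] at h
    exact one_ne_zero h

theorem pureLen_add_le (S : List (Fin 2)) :
    pureLen 0 S + pureLen 1 S ≤ S.count 0 + S.count 1 := by
  rw [count_add_count]
  unfold pureLen
  split_ifs with h1 h2
  · obtain _ | ⟨x, S⟩ := S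
    · rfl
    · exact absurd ((h1 x (by simp)).symm.trans (h2 x (by simp))) (by decide)
  · omega
  · omega
  · omega

theorem pureNum_add_le (S : List (Fin 2)) : pureNum 0 S + pureNum 1 S ≤ 1 := by
  unfold pureNum
  split_ifs with h1 h2
  · obtain _ | ⟨x, S⟩ := S
    · exact absurd rfl h1.1
    · exact absurd ((h1.2 x (by simp)).symm.trans (h2.2 x (by simp))) (by decide)
  · omega
  · omega
  · omega

theorem one_le_count_zero_add {S : List (Fin 2)} (hS : S ≠ []) : 1 ≤ S.count 0 + pureNum 1 S := by
  by_cases h : 0 ∈ S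
  · have := List.count_pos_iff.2 h
    omega
  · rw [pureNum, if_pos ⟨hS, forall_eq_one_iff.2 h⟩]
    omega

theorem one_le_count_one_add {S : List (Fin 2)} (hS : S ≠ []) : 1 ≤ S.count 1 + pureNum 0 S := by
  by_cases h : 1 ∈ S
  · have := List.count_pos_iff.2 h
    omega
  · rw [pureNum, if_pos ⟨hS, forall_eq_zero_iff.2 h⟩]
    omega

/-! ### Cyclic words as sequences of segments of constant sign -/

/-- The relation `R` holds along the list, and from its last element to its first. -/
def CycChain {α : Type*} (R : α → α → Prop) (L : List α) : Prop :=
  L.IsChain R ∧ ∀ x ∈ L.getLast?, ∀ y ∈ L.head?, R x y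

theorem CycChain.rotate {α : Type*} {R : α → α → Prop} {l m : List α} (h : CycChain R (l ++ m)) :
    CycChain R (m ++ l) := by
  obtain _ | ⟨x, l⟩ := l
  · simpa using h
  obtain rfl | ⟨m, y, rfl⟩ := m.eq_nil_or_concat'
  · simpa using h
  obtain ⟨h1, h2⟩ := h
  rw [List.isChain_append] at h1
  obtain ⟨h3, h4, h5⟩ := h1
  refine ⟨List.isChain_append.2 ⟨h4, h3, ?_⟩, ?_⟩
  · rw [← List.append_assoc, List.getLast?_append] at h2
    simpa [List.isChain_append] using h2
  · have : ∀ z ∈ (m ++ [y]).head?, z ∈ (m ++ [y] ++ x :: l).head? := by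
      intro z hz
      obtain _ | ⟨w, m⟩ := m <;> simpa using hz
    intro z hz w hw
    refine h5 z ?_ w ?_
    · simpa [List.getLast?_append] using hz
    · obtain _ | ⟨w, m⟩ := m <;> simpa using hw

/-- Pairs of positive words `(P, Q)`, standing for `P Q⁻¹`. -/
abbrev SegPair : Type := List (Fin 2) × List (Fin 2)

/-- The value `P Q⁻¹` of a pair. -/
def SegPair.val (p : SegPair) : F2 := pos p.1 * (pos p.2)⁻¹

/-- The product of the values of the pairs. -/
def segVal (L : List SegPair) : F2 := (L.map SegPair.val).prod

/-- Absence of cancellation between the second word of a pair and the first word of the next one;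
empty words count as `b`. -/
def SegRel (p q : SegPair) : Prop := p.2.headD 1 ≠ q.1.headD 1

/-- A cyclic sequence of pairs without cancellation, where empty words count as `b`. -/
def WeakSegs (L : List SegPair) : Prop :=
  CycChain SegRel L ∧ ∀ p ∈ L, p.1.getLastD 1 ≠ p.2.getLastD 1

/-- The sum of a quantity over all words of a list of pairs. -/
def segSum (g : List (Fin 2) → ℕ) (L : List SegPair) : ℕ := (L.map fun p => g p.1 + g p.2).sum

/-- Numerical data attached to a cyclic word: the numbers of letters `a^±` and `b^±`, the number of
maximal positive segments followed by a negative one, the number and total length of the segments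
which are powers of `a`, and the same for `b`. -/
structure SegData where
  na : ℕ
  nb : ℕ
  t : ℕ
  da : ℕ
  ba : ℕ
  db : ℕ
  bb : ℕ

/-- The data of a list of pairs. -/
def segData (L : List SegPair) : SegData where
  na := segSum (List.count 0) L
  nb := segSum (List.count 1) L
  t := L.length
  da := segSum (pureNum 0) L
  ba := segSum (pureLen 0) L
  db := segSum (pureNum 1) L
  bb := segSum (pureLen 1) L

/-- The data of a cyclic word of constant sign. -/
def posData (S : List (Fin 2)) : SegData := ⟨S.count 0, S.count 1, 0, 0, 0, 0, 0⟩

/-- `s` is the data of a cyclically reduced word conjugate to `w`. -/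
inductive HasData (w : F2) : SegData → Prop
  | pos (S : List (Fin 2)) (hS : S ≠ []) (h : IsConj (pos S) w) : HasData w (posData S)
  | neg (S : List (Fin 2)) (hS : S ≠ []) (h : IsConj (F2.pos S)⁻¹ w) : HasData w (posData S)
  | mixed (L : List SegPair) (hL : L ≠ []) (hw : WeakSegs L) (hne : ∀ p ∈ L, p.1 ≠ [] ∧ p.2 ≠ [])
      (h : IsConj (segVal L) w) : HasData w (segData L)

theorem HasData.congr {v w : F2} {s : SegData} (h : HasData v s) (hvw : IsConj v w) :
    HasData w s := by
  cases h with
  | pos S hS h => exact .pos S hS (h.trans hvw)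
  | neg S hS h => exact .neg S hS (h.trans hvw)
  | mixed L hL hw hne h => exact .mixed L hL hw hne (h.trans hvw)

@[simp] theorem segVal_nil : segVal [] = 1 := rfl

@[simp] theorem segVal_cons (p : SegPair) (L : List SegPair) :
    segVal (p :: L) = pos p.1 * (pos p.2)⁻¹ * segVal L := by
  simp [segVal, SegPair.val]

@[simp] theorem segVal_append (L M : List SegPair) : segVal (L ++ M) = segVal L * segVal M := by
  simp [segVal]

@[simp] theorem segSum_nil (g : List (Fin 2) → ℕ) : segSum g [] = 0 := rfl

@[simp] theorem segSum_cons (g : List (Fin 2) → ℕ) (p : SegPair) (L : List SegPair) :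
    segSum g (p :: L) = g p.1 + g p.2 + segSum g L := by
  simp [segSum]

@[simp] theorem segSum_append (g : List (Fin 2) → ℕ) (L M : List SegPair) :
    segSum g (L ++ M) = segSum g L + segSum g M := by
  simp [segSum]

theorem segSum_add (g h : List (Fin 2) → ℕ) (L : List SegPair) :
    segSum (fun S => g S + h S) L = segSum g L + segSum h L := by
  induction L with
  | nil => rfl
  | cons p L ih => simp only [segSum_cons, ih]; omega

theorem segSum_two_mul (g : List (Fin 2) → ℕ) (L : List SegPair) :
    segSum (fun S => 2 * g S) L = 2 * segSum g L := by
  induction L with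
  | nil => rfl
  | cons p L ih => simp only [segSum_cons, ih]; omega

theorem segSum_one (L : List SegPair) : segSum (fun _ => 1) L = 2 * L.length := by
  induction L with
  | nil => rfl
  | cons p L ih => simp only [segSum_cons, ih, List.length_cons]; omega

theorem segSum_le {g h : List (Fin 2) → ℕ} {L : List SegPair}
    (hne : ∀ p ∈ L, p.1 ≠ [] ∧ p.2 ≠ []) (hgh : ∀ S, S ≠ [] → g S ≤ h S) :
    segSum g L ≤ segSum h L := by
  induction L with
  | nil => rfl
  | cons p L ih =>
    simp only [segSum_cons]
    have h1 := hgh _ (hne p (by simp)).1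
    have h2 := hgh _ (hne p (by simp)).2
    have h3 := ih fun q hq => hne q (by simp [hq])
    omega

theorem segSum_congr {g h : List (Fin 2) → ℕ} {L : List SegPair}
    (hne : ∀ p ∈ L, p.1 ≠ [] ∧ p.2 ≠ []) (hgh : ∀ S, S ≠ [] → g S = h S) :
    segSum g L = segSum h L :=
  le_antisymm (segSum_le hne fun S hS => (hgh S hS).le) (segSum_le hne fun S hS => (hgh S hS).ge)

theorem segSum_eq_zero {g : List (Fin 2) → ℕ} {L : List SegPair} :
    segSum g L = 0 ↔ ∀ p ∈ L, g p.1 = 0 ∧ g p.2 = 0 := by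
  induction L with
  | nil => simp
  | cons p L ih => simp [ih]

theorem segSum_map (g : List (Fin 2) → ℕ) (f : List (Fin 2) → List (Fin 2)) (L : List SegPair) :
    segSum g (L.map fun p => (f p.1, f p.2)) = segSum (fun S => g (f S)) L := by
  simp [segSum, Function.comp_def]

/-! ### Removing vanished segments by merging neighbours -/

theorem CycChain.merge {α : Type*} {R : α → α → Prop} {x y w : α} {l : List α}
    (h : CycChain R (x :: y :: l)) (h1 : ∀ z, R z x → R z w) (h2 : ∀ z, R y z → R w z) :
    CycChain R (w :: l) := by
  obtain ⟨hc, hl⟩ := h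
  obtain rfl | ⟨l, u, rfl⟩ := l.eq_nil_or_concat'
  · refine ⟨List.isChain_singleton _, ?_⟩
    have : R y x := by simpa using hl
    simpa using h2 _ (h1 _ this)
  · rw [List.isChain_cons, List.isChain_cons] at hc
    refine ⟨List.isChain_cons.2 ⟨fun z hz => h2 z (hc.2.1 z hz), hc.2.2⟩, ?_⟩
    have hux : R u x := by
      have : (x :: y :: (l ++ [u])).getLast? = some u := by
        simp [List.getLast?_cons, List.getLast?_append]
      exact hl u this x rfl
    have : (w :: (l ++ [u])).getLast? = some u := by
      simp [List.getLast?_cons, List.getLast?_append]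
    intro z hz v hv
    rw [this] at hz
    cases hz
    cases hv
    exact h1 _ hux

theorem WeakSegs.rotate {l m : List SegPair} (h : WeakSegs (l ++ m)) : WeakSegs (m ++ l) :=
  ⟨h.1.rotate, fun p hp => h.2 p (by simpa [or_comm] using hp)⟩

theorem isConj_segVal_rotate (l m : List SegPair) : IsConj (segVal (m ++ l)) (segVal (l ++ m)) := by
  rw [isConj_iff]
  refine ⟨segVal l, ?_⟩
  rw [segVal_append, segVal_append]
  group

theorem segSum_rotate (g : List (Fin 2) → ℕ) (l m : List SegPair) :
    segSum g (m ++ l) = segSum g (l ++ m) := by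
  rw [segSum_append, segSum_append, add_comm]

theorem pureLen_append_le (i : Fin 2) (S T : List (Fin 2)) :
    pureLen i (S ++ T) ≤ pureLen i S + pureLen i T := by
  unfold pureLen
  by_cases h : ∀ x ∈ S ++ T, x = i
  · rw [if_pos h, if_pos fun x hx => h x (by simp [hx]), if_pos fun x hx => h x (by simp [hx]),
      List.length_append]
  · rw [if_neg h]
    exact Nat.zero_le _

theorem pureLen_one_eq_zero {S : List (Fin 2)} (h : 0 ∈ S) : pureLen 1 S = 0 :=
  if_neg fun H => forall_eq_one_iff.1 H h

theorem zero_mem_of_headD {S : List (Fin 2)} (h : S.headD 1 ≠ 1) : 0 ∈ S := by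
  obtain _ | ⟨x, S⟩ := S
  · exact absurd rfl h
  · rcases eq_zero_or_one x with rfl | rfl
    · simp
    · exact absurd rfl h

theorem zero_mem_of_getLastD {S : List (Fin 2)} (h : S.getLastD 1 ≠ 1) : 0 ∈ S := by
  obtain rfl | ⟨S, x, rfl⟩ := S.eq_nil_or_concat'
  · exact absurd rfl h
  · rcases eq_zero_or_one x with rfl | rfl
    · simp
    · exact absurd (by simp) h

theorem headD_append {S T : List (Fin 2)} (h : S ≠ []) : (S ++ T).headD 1 = S.headD 1 := by
  obtain _ | ⟨x, S⟩ := S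
  · exact absurd rfl h
  · rfl

theorem getLastD_append {S T : List (Fin 2)} (h : T ≠ []) : (S ++ T).getLastD 1 = T.getLastD 1 := by
  obtain rfl | ⟨T, x, rfl⟩ := T.eq_nil_or_concat'
  · exact absurd rfl h
  · simp [List.getLastD_eq_getLast?, List.getLast?_append]

/-- The conclusion of `exists_hasData_segVal`. -/
def Normalizable (L : List SegPair) : Prop :=
  ∃ s, HasData (segVal L) s ∧ s.na = segSum (List.count 0) L ∧ s.nb = segSum (List.count 1) L ∧
    s.t + segSum emptyNum L = L.length ∧ s.bb = segSum (pureLen 1) L ∧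
    s.ba ≤ segSum (pureLen 0) L ∧ (segSum emptyNum L = 0 → s = segData L)

/-- Rotation changes the value only by conjugation and the sums not at all; an empty word makes the
last clause vacuous. -/
theorem Normalizable.rotate {l m : List SegPair} (h : Normalizable (m ++ l))
    (he : segSum emptyNum (l ++ m) ≠ 0) : Normalizable (l ++ m) := by
  obtain ⟨s, h1, h2, h3, h4, h5, h6, -⟩ := h
  rw [segSum_rotate] at h2 h3 h4 h5 h6
  refine ⟨s, h1.congr (isConj_segVal_rotate l m), h2, h3, ?_, h5, h6, fun h => absurd h he⟩
  rw [h4, List.length_append, List.length_append, add_comm]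

theorem emptyNum_nil : emptyNum [] = 1 := rfl

theorem emptyNum_of_ne {S : List (Fin 2)} (h : S ≠ []) : emptyNum S = 0 := if_neg h

/-- When the only positive segment has vanished, a word of constant sign remains. It contains an a,
because its last letter differs from the b that the empty word stands for; hence no pure b-length is
lost. -/
theorem normalizable_singleton_nil_left {Q : List (Fin 2)} (h : WeakSegs [([], Q)]) :
    Normalizable [([], Q)] := by
  have h0 : 0 ∈ Q := zero_mem_of_getLastD (h.2 ([], Q) (by simp)).symm
  have hne := List.ne_nil_of_mem h0
  refine ⟨posData Q, .neg Q hne ?_, ?_, ?_, ?_, ?_, Nat.zero_le _, ?_⟩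
  · exact isConj_iff.2 ⟨1, by simp⟩
  · simp [posData]
  · simp [posData]
  · simp [posData, emptyNum_nil, emptyNum_of_ne hne]
  · simp [posData, pureLen_one_eq_zero h0]
    rfl
  · simp [emptyNum_nil]

theorem normalizable_singleton_nil_right {P : List (Fin 2)} (h : WeakSegs [(P, [])]) :
    Normalizable [(P, [])] := by
  have h0 : 0 ∈ P := zero_mem_of_getLastD (h.2 (P, []) (by simp))
  have hne := List.ne_nil_of_mem h0
  refine ⟨posData P, .pos P hne ?_, ?_, ?_, ?_, ?_, Nat.zero_le _, ?_⟩
  · exact isConj_iff.2 ⟨1, by simp⟩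
  · simp [posData]
  · simp [posData]
  · simp [posData, emptyNum_nil, emptyNum_of_ne hne]
  · simp [posData, pureLen_one_eq_zero h0]
    rfl
  · simp [emptyNum_nil]

/-- The neighbours become Q₀⁻¹Q⁻¹ = (QQ₀)⁻¹, whence the reversed order. As the empty word counts as
b, both letters adjacent to it are a. So neither neighbour nor their union is a power of b and the
pure b-length is unchanged, while the pure a-length can only drop. -/
theorem normalizable_nil_left {P₀ Q₀ Q : List (Fin 2)} {L : List SegPair}
    (h : WeakSegs ((P₀, Q₀) :: ([], Q) :: L))
    (ih : WeakSegs ((P₀, Q ++ Q₀) :: L) → Normalizable ((P₀, Q ++ Q₀) :: L)) :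
    Normalizable ((P₀, Q₀) :: ([], Q) :: L) := by
  have h0 : 0 ∈ Q := zero_mem_of_getLastD (h.2 ([], Q) (by simp)).symm
  have hne := List.ne_nil_of_mem h0
  have h1 : 0 ∈ Q₀ := zero_mem_of_headD (List.isChain_cons_cons.1 h.1.1).1
  have hne₀ := List.ne_nil_of_mem h1
  obtain ⟨s, h2, h3, h4, h5, h6, h7, -⟩ := ih ⟨h.1.merge (fun z hz => hz) (fun z hz => by
      rw [SegRel, headD_append hne]
      exact hz), fun p hp => by
    rcases List.mem_cons.1 hp with rfl | hp
    · rw [getLastD_append hne₀]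
      exact h.2 (P₀, Q₀) (by simp)
    · exact h.2 p (by simp [hp])⟩
  refine ⟨s, ?_, ?_, ?_, ?_, ?_, ?_, ?_⟩
  · convert h2 using 1
    simp [pos_append, mul_assoc]
  · simp only [h3, segSum_cons, List.count_append, List.count_nil]
    omega
  · simp only [h4, segSum_cons, List.count_append, List.count_nil]
    omega
  · simp only [segSum_cons, List.length_cons, emptyNum_nil, emptyNum_of_ne hne,
      emptyNum_of_ne hne₀, emptyNum_of_ne (List.append_ne_nil_of_left_ne_nil hne Q₀)] at h5 ⊢
    omega
  · simp only [h6, segSum_cons, pureLen_one_eq_zero h0, pureLen_one_eq_zero h1,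
      pureLen_one_eq_zero (List.mem_append_left Q₀ h0), show pureLen 1 [] = 0 from rfl]
    omega
  · have := pureLen_append_le 0 Q Q₀
    simp only [segSum_cons] at h7 ⊢
    omega
  · simp [emptyNum_nil]

theorem normalizable_nil_right {P P₁ Q₁ : List (Fin 2)} {L : List SegPair}
    (h : WeakSegs ((P, []) :: (P₁, Q₁) :: L))
    (ih : WeakSegs ((P ++ P₁, Q₁) :: L) → Normalizable ((P ++ P₁, Q₁) :: L)) :
    Normalizable ((P, []) :: (P₁, Q₁) :: L) := by
  have h0 : 0 ∈ P := zero_mem_of_getLastD (h.2 (P, []) (by simp))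
  have hne := List.ne_nil_of_mem h0
  have h1 : 0 ∈ P₁ := zero_mem_of_headD (List.isChain_cons_cons.1 h.1.1).1.symm
  have hne₁ := List.ne_nil_of_mem h1
  obtain ⟨s, h2, h3, h4, h5, h6, h7, -⟩ := ih ⟨h.1.merge (fun z hz => by
      rw [SegRel, headD_append hne]
      exact hz) (fun z hz => hz), fun p hp => by
    rcases List.mem_cons.1 hp with rfl | hp
    · rw [getLastD_append hne₁]
      exact h.2 (P₁, Q₁) (by simp)
    · exact h.2 p (by simp [hp])⟩
  refine ⟨s, ?_, ?_, ?_, ?_, ?_, ?_, ?_⟩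
  · convert h2 using 1
    simp [pos_append, mul_assoc]
  · simp only [h3, segSum_cons, List.count_append, List.count_nil]
    omega
  · simp only [h4, segSum_cons, List.count_append, List.count_nil]
    omega
  · simp only [segSum_cons, List.length_cons, emptyNum_nil, emptyNum_of_ne hne,
      emptyNum_of_ne hne₁, emptyNum_of_ne (List.append_ne_nil_of_left_ne_nil hne P₁)] at h5 ⊢
    omega
  · simp only [h6, segSum_cons, pureLen_one_eq_zero h0, pureLen_one_eq_zero h1,
      pureLen_one_eq_zero (List.mem_append_left P₁ h0), show pureLen 1 [] = 0 from rfl]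
    omega
  · have := pureLen_append_le 0 P P₁
    simp only [segSum_cons] at h7 ⊢
    omega
  · simp [emptyNum_nil]

/-- Empty words in a cyclic sequence of pairs can be removed by merging their neighbours. -/
theorem exists_hasData_segVal (n : ℕ) : ∀ L : List SegPair, L.length = n → L ≠ [] → WeakSegs L →
    Normalizable L := by
  induction n with
  | zero => exact fun L h h' => absurd (List.length_eq_zero_iff.1 h) h'
  | succ n ih =>
    intro L hn hL hw
    by_cases he : segSum emptyNum L = 0
    · refine ⟨segData L, .mixed L hL hw (fun p hp => ?_) (IsConj.refl _), rfl, rfl, by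
        rw [he]; rfl, rfl, le_rfl, fun _ => rfl⟩
      have := segSum_eq_zero.1 he p hp
      simpa [emptyNum] using this
    · have : ∃ p ∈ L, p.1 = [] ∨ p.2 = [] := by
        by_contra! H
        exact he (segSum_eq_zero.2 fun p hp => ⟨if_neg (H p hp).1, if_neg (H p hp).2⟩)
      obtain ⟨⟨P, Q⟩, hp, hpq⟩ := this
      obtain ⟨l, m, rfl⟩ := List.append_of_mem hp
      have he' := he
      rw [← segSum_rotate] at he'
      have hw' := hw.rotate
      have hlen : (m ++ l).length = n := by
        simp only [List.length_append, List.length_cons] at hn ⊢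
        omega
      -- Rotate so that the pair containing an empty word comes first.
      refine Normalizable.rotate ?_ he
      rw [List.cons_append] at hw' he' ⊢
      generalize m ++ l = r at *
      rcases hpq with h | h
      · obtain rfl : P = [] := h
        obtain rfl | ⟨r, ⟨P₀, Q₀⟩, rfl⟩ := r.eq_nil_or_concat'
        · exact normalizable_singleton_nil_left hw'
        -- An empty positive word merges with the cyclic predecessor of its pair, which is therefore
        -- rotated to the front.
        · have h1 := WeakSegs.rotate (l := ([], Q) :: r) (m := [(P₀, Q₀)]) (by simpa using hw')
          have h2 := Normalizable.rotate (l := ([], Q) :: r) (m := [(P₀, Q₀)])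
            (normalizable_nil_left h1 fun h3 => ih _ (by simpa using hlen) (by simp) h3)
            (by simpa using he')
          simpa using h2
      · obtain rfl : Q = [] := h
        obtain _ | ⟨⟨P₁, Q₁⟩, r⟩ := r
        · exact normalizable_singleton_nil_right hw'
        · exact normalizable_nil_right hw' fun h3 => ih _ (by simpa using hlen) (by simp) h3

/-! ### The action of σ on segment data, and invariants -/

/-- The final b of σ(P) cancels against the b⁻¹ at the beginning of σ(Q)⁻¹. -/
theorem sigma_segVal {L : List SegPair} (hne : ∀ p ∈ L, p.1 ≠ [] ∧ p.2 ≠ []) :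
    sigma (segVal L) = segVal (L.map fun p => (sigmaSeg p.1, sigmaSeg p.2)) := by
  induction L with
  | nil => simp
  | cons p L ih =>
    have hp := hne p (by simp)
    rw [segVal_cons, map_mul, map_mul, map_inv, ih fun q hq => hne q (by simp [hq]),
      sigma_pos hp.1, sigma_pos hp.2, List.map_cons, segVal_cons]
    group

theorem WeakSegs.map_sigmaSeg {L : List SegPair} (h : WeakSegs L) :
    WeakSegs (L.map fun p => (sigmaSeg p.1, sigmaSeg p.2)) := by
  refine ⟨⟨?_, ?_⟩, ?_⟩
  · rw [List.isChain_map]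
    refine h.1.1.imp fun p q hpq => ?_
    simpa only [SegRel, headD_sigmaSeg] using hpq
  · intro x hx y hy
    rw [List.getLast?_map] at hx
    rw [List.head?_map] at hy
    obtain ⟨x', hx', rfl⟩ := Option.map_eq_some_iff.1 hx
    obtain ⟨y', hy', rfl⟩ := Option.map_eq_some_iff.1 hy
    simpa only [SegRel, headD_sigmaSeg] using h.1.2 x' hx' y' hy'
  · intro p hp
    obtain ⟨q, hq, rfl⟩ := List.mem_map.1 hp
    simpa only [getLastD_sigmaSeg] using h.2 q hq

/-- The effect of `σ` on the data of a cyclic word. -/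
def SigmaStep (s s' : SegData) : Prop :=
  s'.na = s.na ∧ s'.nb + 2 * s.t = s.nb + s.na ∧ s'.bb + s.db = s.bb ∧ s'.ba ≤ s.da ∧
    ∃ e, s'.t + e = s.t ∧ e ≤ s.db ∧ 2 * s.db ≤ s.bb + e ∧
      (e = 0 → s'.da = s'.ba ∧ 2 * s.da ≤ s.ba + s'.ba)

theorem sigma_pos_isConj {S : List (Fin 2)} (hS : S ≠ []) :
    IsConj (pos (1 :: sigmaSeg S)) (sigma (pos S)) := by
  rw [sigma_pos hS, pos_cons, isConj_iff]
  refine ⟨b⁻¹, ?_⟩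
  change b⁻¹ * (b * _) * _ = _
  group

theorem sigmaStep_posData {S : List (Fin 2)} (hS : S ≠ []) :
    SigmaStep (posData S) (posData (1 :: sigmaSeg S)) := by
  refine ⟨?_, ?_, rfl, le_rfl, 0, rfl, le_rfl, le_rfl, fun _ => ⟨rfl, le_rfl⟩⟩
  · simp [posData, count_zero_sigmaSeg]
  · have := count_one_sigmaSeg hS
    simp [posData]
    omega

theorem HasData.sigma {w : F2} {s : SegData} (h : HasData w s) :
    ∃ s', HasData (sigma w) s' ∧ SigmaStep s s' := by
  have hmap : ∀ {x y : F2}, IsConj x y → IsConj (F2.sigma x) (F2.sigma y) := by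
    intro x y hxy
    obtain ⟨g, rfl⟩ := isConj_iff.1 hxy
    exact isConj_iff.2 ⟨F2.sigma g, by simp⟩
  cases h with
  | pos S hS h =>
    exact ⟨_, .pos (1 :: sigmaSeg S) (by simp) ((sigma_pos_isConj hS).trans (hmap h)),
      sigmaStep_posData hS⟩
  | neg S hS h =>
    refine ⟨_, .neg (1 :: sigmaSeg S) (by simp) (IsConj.trans ?_ (hmap h)), sigmaStep_posData hS⟩
    obtain ⟨g, hg⟩ := isConj_iff.1 (sigma_pos_isConj hS)
    rw [map_inv, ← hg]
    exact isConj_iff.2 ⟨g, by group⟩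
  | mixed L hL hw hne h =>
    obtain ⟨s', h1, h2, h3, h4, h5, h6, h7⟩ := exists_hasData_segVal _ _ rfl
      (by simpa using hL) hw.map_sigmaSeg
    rw [← sigma_segVal hne] at h1
    rw [segSum_map] at h2 h3 h4 h5 h6 h7
    rw [List.length_map] at h4
    have e1 := segSum_congr (h := List.count 0) hne fun S _ => count_zero_sigmaSeg S
    have e2 := segSum_congr (g := fun S => (sigmaSeg S).count 1 + 1)
      (h := fun S => S.count 0 + S.count 1) hne fun S hS => count_one_sigmaSeg hS
    have e3 := segSum_congr (g := fun S => pureLen 1 (sigmaSeg S) + pureNum 1 S)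
      (h := pureLen 1) hne fun S hS => (sigmaSeg_pure_one hS).1
    have e4 := segSum_le (g := fun S => emptyNum (sigmaSeg S))
      (h := pureNum 1) hne fun S hS => (sigmaSeg_pure_one hS).2.1
    have e5 := segSum_le (g := fun S => 2 * pureNum 1 S)
      (h := fun S => pureLen 1 S + emptyNum (sigmaSeg S)) hne
      fun S hS => (sigmaSeg_pure_one hS).2.2
    have e6 := segSum_le (g := fun S => pureLen 0 (sigmaSeg S))
      (h := pureNum 0) hne fun S hS => (sigmaSeg_pure_zero hS).1
    have e7 := segSum_congr (g := fun S => pureNum 0 (sigmaSeg S))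
      (h := fun S => pureLen 0 (sigmaSeg S)) hne fun S hS => (sigmaSeg_pure_zero hS).2.1
    have e8 := segSum_le (g := fun S => 2 * pureNum 0 S)
      (h := fun S => pureLen 0 S + pureLen 0 (sigmaSeg S)) hne
      fun S hS => (sigmaSeg_pure_zero hS).2.2
    simp only [segSum_add, segSum_two_mul, segSum_one] at e1 e2 e3 e4 e5 e6 e7 e8
    -- The witness for e is the number of empty words among the images. If it is zero nothing
    -- merges, and the data are exactly those of the list of images.
    refine ⟨s', h1.congr (hmap h), ?_, ?_, ?_, ?_, _, h4, e4, e5, ?_⟩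
    · rw [h2, e1]; rfl
    · rw [h3]; simp only [segData]; omega
    · rw [h5]; exact e3
    · exact h6.trans e6
    · intro he
      rw [h7 he]
      simp only [segData, segSum_map]
      exact ⟨e7, e8⟩

/-- Relations between the data of a cyclic word. -/
theorem HasData.invariants {w : F2} {s : SegData} (h : HasData w s) :
    s.da ≤ s.ba ∧ s.db ≤ s.bb ∧ (s.da = 0 → s.ba = 0) ∧ (s.db = 0 → s.bb = 0) ∧
      s.ba + s.bb ≤ s.na + s.nb ∧ 2 * s.t ≤ s.na + s.db ∧ 2 * s.t ≤ s.nb + s.da ∧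
      s.da + s.db ≤ 2 * s.t := by
  have hpos : ∀ S : List (Fin 2), (posData S).da ≤ (posData S).ba ∧
      (posData S).db ≤ (posData S).bb ∧
      ((posData S).da = 0 → (posData S).ba = 0) ∧ ((posData S).db = 0 → (posData S).bb = 0) ∧
      (posData S).ba + (posData S).bb ≤ (posData S).na + (posData S).nb ∧
      2 * (posData S).t ≤ (posData S).na + (posData S).db ∧
      2 * (posData S).t ≤ (posData S).nb + (posData S).da ∧
      (posData S).da + (posData S).db ≤ 2 * (posData S).t := by
    intro S
    simp [posData]
  cases h with
  | pos S hS h => exact hpos S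
  | neg S hS h => exact hpos S
  | mixed L hL hw hne h =>
    have e1 := segSum_le (g := fun S => pureLen 0 S + pureLen 1 S)
      (h := fun S => S.count 0 + S.count 1) hne fun S _ => pureLen_add_le S
    -- Each of the 2t segments contains an a or is a power of b; the next bound is its counterpart
    -- for b.
    have e2 := segSum_le (g := fun _ => 1) (h := fun S => S.count 0 + pureNum 1 S) hne
      fun S hS => one_le_count_zero_add hS
    have e3 := segSum_le (g := fun _ => 1) (h := fun S => S.count 1 + pureNum 0 S) hne
      fun S hS => one_le_count_one_add hS
    have e4 := segSum_le (g := fun S => pureNum 0 S + pureNum 1 S) (h := fun _ => 1) hne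
      fun S _ => pureNum_add_le S
    simp only [segSum_add, segSum_one] at e1 e2 e3 e4
    refine ⟨segSum_le hne fun S _ => pureNum_le_pureLen 0 S,
      segSum_le hne fun S _ => pureNum_le_pureLen 1 S, fun h0 => ?_, fun h0 => ?_, e1, e2, e3, e4⟩
    · exact segSum_eq_zero.2 fun p hp =>
        ⟨pureLen_eq_zero (segSum_eq_zero.1 h0 p hp).1, pureLen_eq_zero (segSum_eq_zero.1 h0 p hp).2⟩
    · exact segSum_eq_zero.2 fun p hp =>
        ⟨pureLen_eq_zero (segSum_eq_zero.1 h0 p hp).1, pureLen_eq_zero (segSum_eq_zero.1 h0 p hp).2⟩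

/-! ### Exchanging a and b -/

/-- The exchange of the two letters. -/
def other (x : Fin 2) : Fin 2 := 1 - x

theorem other_ne {x y : Fin 2} : other x ≠ other y ↔ x ≠ y := by revert x y; decide

theorem swapAut_pos (S : List (Fin 2)) : swapAut (pos S) = pos (S.map other) := by
  induction S with
  | nil => simp
  | cons x S ih =>
    rw [pos_cons, map_mul, ih, List.map_cons, pos_cons]
    congr 1
    rcases eq_zero_or_one x with rfl | rfl
    · exact swapAut_a
    · exact swapAut_b

theorem swapAut_segVal (L : List SegPair) :
    swapAut (segVal L) = segVal (L.map fun p => (p.1.map other, p.2.map other)) := by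
  induction L with
  | nil => simp
  | cons p L ih => simp [ih, swapAut_pos]

theorem headD_map_other {S : List (Fin 2)} (h : S ≠ []) :
    (S.map other).headD 1 = other (S.headD 1) := by
  obtain _ | ⟨x, S⟩ := S
  · exact absurd rfl h
  · rfl

theorem getLastD_map_other {S : List (Fin 2)} (h : S ≠ []) :
    (S.map other).getLastD 1 = other (S.getLastD 1) := by
  obtain rfl | ⟨S, x, rfl⟩ := S.eq_nil_or_concat'
  · exact absurd rfl h
  · simp

theorem WeakSegs.map_other {L : List SegPair} (h : WeakSegs L)
    (hne : ∀ p ∈ L, p.1 ≠ [] ∧ p.2 ≠ []) :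
    WeakSegs (L.map fun p => (p.1.map other, p.2.map other)) := by
  have key : ∀ p ∈ L, ∀ q ∈ L, SegRel p q →
      SegRel (p.1.map other, p.2.map other) (q.1.map other, q.2.map other) := by
    intro p hp q hq hpq
    rw [SegRel, headD_map_other (hne p hp).2, headD_map_other (hne q hq).1]
    exact other_ne.2 hpq
  refine ⟨⟨?_, ?_⟩, ?_⟩
  · rw [List.isChain_map]
    exact h.1.1.imp_of_mem_imp fun p q hp hq => key p hp q hq
  · intro x hx y hy
    rw [List.getLast?_map] at hx
    rw [List.head?_map] at hy
    obtain ⟨x', hx', rfl⟩ := Option.map_eq_some_iff.1 hx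
    obtain ⟨y', hy', rfl⟩ := Option.map_eq_some_iff.1 hy
    exact key _ (List.mem_of_getLast? hx') _ (List.mem_of_head? hy') (h.1.2 x' hx' y' hy')
  · intro p hp
    obtain ⟨q, hq, rfl⟩ := List.mem_map.1 hp
    rw [getLastD_map_other (hne q hq).1, getLastD_map_other (hne q hq).2]
    exact other_ne.2 (h.2 q hq)

theorem count_map_other (i : Fin 2) (S : List (Fin 2)) :
    (S.map other).count (other i) = S.count i :=
  List.count_map_of_injective _ _ (by decide) _

theorem forall_map_other (i : Fin 2) (S : List (Fin 2)) :
    (∀ x ∈ S.map other, x = other i) ↔ ∀ x ∈ S, x = i := by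
  have : ∀ x i : Fin 2, other x = other i ↔ x = i := by decide
  simp only [List.forall_mem_map, this]

theorem pureLen_map_other (i : Fin 2) (S : List (Fin 2)) :
    pureLen (other i) (S.map other) = pureLen i S := by
  simp only [pureLen, forall_map_other, List.length_map]

theorem pureNum_map_other (i : Fin 2) (S : List (Fin 2)) :
    pureNum (other i) (S.map other) = pureNum i S := by
  simp only [pureNum, forall_map_other, List.map_eq_nil_iff, ne_eq]

/-- The data obtained by exchanging the roles of `a` and `b`. -/
def SegData.swap (s : SegData) : SegData := ⟨s.nb, s.na, s.t, s.db, s.bb, s.da, s.ba⟩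

theorem HasData.swap {w : F2} {s : SegData} (h : HasData w s) :
    HasData (swapAut w) s.swap := by
  have hmap : ∀ {x y : F2}, IsConj x y → IsConj (swapAut x) (swapAut y) := by
    intro x y hxy
    obtain ⟨g, rfl⟩ := isConj_iff.1 hxy
    exact isConj_iff.2 ⟨swapAut g, by simp⟩
  have hpos : ∀ S, (posData S).swap = posData (S.map other) := by
    intro S
    have h0 := count_map_other 0 S
    have h1 := count_map_other 1 S
    rw [show other 0 = 1 from rfl] at h0
    rw [show other 1 = 0 from rfl] at h1
    simp [posData, SegData.swap, h0, h1]
  cases h with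
  | pos S hS h =>
    rw [hpos]
    refine .pos _ (by simpa using hS) ?_
    rw [← swapAut_pos]
    exact hmap h
  | neg S hS h =>
    rw [hpos]
    refine .neg _ (by simpa using hS) ?_
    rw [← swapAut_pos, ← map_inv]
    exact hmap h
  | mixed L hL hw hne h =>
    have hs : (segData L).swap = segData (L.map fun p => (p.1.map other, p.2.map other)) := by
      simp only [segData, SegData.swap, segSum_map, List.length_map]
      congr
      · exact funext fun S => (count_map_other 1 S).symm
      · exact funext fun S => (count_map_other 0 S).symm
      · exact funext fun S => (pureNum_map_other 1 S).symm
      · exact funext fun S => (pureLen_map_other 1 S).symm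
      · exact funext fun S => (pureNum_map_other 0 S).symm
      · exact funext fun S => (pureLen_map_other 0 S).symm
    rw [hs]
    refine .mixed _ (by simpa using hL) (hw.map_other hne) ?_ ?_
    · intro p hp
      obtain ⟨q, hq, rfl⟩ := List.mem_map.1 hp
      simpa using hne q hq
    · rw [← swapAut_segVal]
      exact hmap h

/-! ### Segment data compute cyclic length and exist for nontrivial elements -/

/-- The word `P Q⁻¹`. -/
def SegPair.word (p : SegPair) : List (Fin 2 × Bool) :=
  p.1.map (fun i => (i, true)) ++ p.2.reverse.map fun i => (i, false)

theorem mk_word (p : SegPair) : FreeGroup.mk p.word = p.val := by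
  rw [SegPair.word, ← FreeGroup.mul_mk, SegPair.val, pos, pos, FreeGroup.inv_mk,
    FreeGroup.invRev]
  simp [Function.comp_def]

theorem mk_flatMap_word (L : List SegPair) : FreeGroup.mk (L.flatMap SegPair.word) = segVal L := by
  induction L with
  | nil => rfl
  | cons p L ih =>
    rw [List.flatMap_cons, ← FreeGroup.mul_mk, ih, mk_word, segVal_cons, SegPair.val]

theorem isReduced_map_const (S : List (Fin 2)) (c : Bool) :
    FreeGroup.IsReduced (S.map fun i => (i, c)) := by
  rw [FreeGroup.IsReduced, List.isChain_map]
  exact (List.pairwise_of_forall fun _ _ _ => rfl).isChain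

theorem word_ne_nil {p : SegPair} (hp : p.1 ≠ []) : p.word ≠ [] := by
  simp [SegPair.word, hp]

theorem head?_word {p : SegPair} (hp : p.1 ≠ []) : p.word.head? = some (p.1.headD 1, true) := by
  obtain ⟨_ | ⟨x, P⟩, Q⟩ := p
  · exact absurd rfl hp
  · rfl

theorem getLast?_word {p : SegPair} (hp : p.2 ≠ []) :
    p.word.getLast? = some (p.2.headD 1, false) := by
  obtain ⟨P, _ | ⟨x, Q⟩⟩ := p
  · exact absurd rfl hp
  · simp [SegPair.word]

theorem isReduced_word {p : SegPair} (hl : p.1.getLastD 1 ≠ p.2.getLastD 1) :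
    FreeGroup.IsReduced p.word := by
  refine List.isChain_append.2 ⟨isReduced_map_const _ _, isReduced_map_const _ _, ?_⟩
  intro x hx y hy
  rw [List.getLast?_map] at hx
  rw [List.head?_map, List.head?_reverse] at hy
  obtain ⟨x', hx', rfl⟩ := Option.map_eq_some_iff.1 hx
  obtain ⟨y', hy', rfl⟩ := Option.map_eq_some_iff.1 hy
  rw [List.getLastD_eq_getLast?, List.getLastD_eq_getLast?, hx', hy'] at hl
  exact fun h => absurd h hl

theorem isCyclicallyReduced_flatMap {L : List SegPair} (hw : WeakSegs L)
    (hne : ∀ p ∈ L, p.1 ≠ [] ∧ p.2 ≠ []) :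
    FreeGroup.IsCyclicallyReduced (L.flatMap SegPair.word) := by
  have key : ∀ p ∈ L, ∀ q ∈ L, SegRel p q → ∀ x ∈ p.word.getLast?, ∀ y ∈ q.word.head?,
      x.1 = y.1 → x.2 = y.2 := by
    intro p hp q hq hpq x hx y hy
    rw [getLast?_word (hne p hp).2] at hx
    rw [head?_word (hne q hq).1] at hy
    cases hx
    cases hy
    exact fun h => absurd h hpq
  refine ⟨?_, ?_⟩
  · rw [FreeGroup.IsReduced, List.flatMap_def, List.isChain_flatten]
    · refine ⟨?_, ?_⟩
      · intro l hl
        obtain ⟨p, hp, rfl⟩ := List.mem_map.1 hl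
        exact isReduced_word (hw.2 p hp)
      · rw [List.isChain_map]
        exact hw.1.1.imp_of_mem_imp fun p q hp hq => key p hp q hq
    · intro h
      obtain ⟨p, hp, h⟩ := List.mem_map.1 h
      exact word_ne_nil (hne p hp).1 h
  · obtain rfl | ⟨L, q, rfl⟩ := L.eq_nil_or_concat'
    · simp
    · intro x hx y hy
      have hx' : x ∈ q.word.getLast? := by
        rw [List.flatMap_append, List.getLast?_append] at hx
        have h := getLast?_word (hne q (by simp)).2
        simpa [h] using hx
      have hy' : ∃ p ∈ (L ++ [q]).head?, y ∈ p.word.head? := by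
        obtain _ | ⟨p, L⟩ := L
        · exact ⟨q, rfl, by simpa using hy⟩
        · refine ⟨p, rfl, ?_⟩
          have h := head?_word (hne p (by simp)).1
          rw [List.cons_append, List.flatMap_cons, List.head?_append] at hy
          simpa [h] using hy
      obtain ⟨p, hp, hy'⟩ := hy'
      exact key q (by simp) p (List.mem_of_head? hp) (hw.1.2 q (by simp) p hp) x hx' y hy'

theorem length_flatMap_word (L : List SegPair) : (L.flatMap SegPair.word).length =
    segSum (List.count 0) L + segSum (List.count 1) L := by
  induction L with
  | nil => rfl
  | cons p L ih =>
    have h1 := count_add_count p.1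
    have h2 := count_add_count p.2
    simp only [List.flatMap_cons, List.length_append, ih, segSum_cons, SegPair.word,
      List.length_map, List.length_reverse]
    omega

theorem cycLen_pos_word (S : List (Fin 2)) : cycLen (pos S) = S.count 0 + S.count 1 := by
  rw [pos, cycLen_mk_of_isCyclicallyReduced, List.length_map, count_add_count]
  refine ⟨isReduced_map_const _ _, ?_⟩
  intro x hx y hy _
  obtain ⟨_, _, rfl⟩ := List.mem_map.1 (List.mem_of_getLast? hx)
  obtain ⟨_, _, rfl⟩ := List.mem_map.1 (List.mem_of_head? hy)
  rfl

theorem HasData.cycLen_eq {w : F2} {s : SegData} (h : HasData w s) : cycLen w = s.na + s.nb := by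
  cases h with
  | pos S hS h => rw [← cycLen_congr h, cycLen_pos_word]; rfl
  | neg S hS h => rw [← cycLen_congr h, cycLen_inv, cycLen_pos_word]; rfl
  | mixed L hL hw hne h =>
    rw [← cycLen_congr h, ← mk_flatMap_word,
      cycLen_mk_of_isCyclicallyReduced (isCyclicallyReduced_flatMap hw hne), length_flatMap_word]
    rfl

/-- A reduced word ending with a negative letter is cut into segments of constant sign. -/
theorem exists_segments (W : List (Fin 2 × Bool)) (hr : FreeGroup.IsReduced W) (hne : W ≠ [])
    (hlast : ∀ x ∈ W.getLast?, x.2 = false) :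
    ∃ (Q : List (Fin 2)) (L : List SegPair), W = (Q.reverse.map fun i => (i, false)) ++
        L.flatMap SegPair.word ∧ L.IsChain SegRel ∧
      (∀ p ∈ L, p.1.getLastD 1 ≠ p.2.getLastD 1) ∧ (∀ p ∈ L, p.1 ≠ [] ∧ p.2 ≠ []) ∧
      (Q ≠ [] → ∀ p ∈ L.head?, Q.headD 1 ≠ p.1.headD 1) := by
  induction W with
  | nil => exact absurd rfl hne
  | cons x W ih =>
    obtain ⟨i, c⟩ := x
    by_cases hW : W = []
    · subst hW
      obtain rfl : c = false := hlast (i, c) (by simp)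
      exact ⟨[i], [], by simp, by simp, by simp, by simp, by simp⟩
    · rw [FreeGroup.IsReduced, List.isChain_cons] at hr
      obtain ⟨Q, L, hQL, h1, h2, h3, h4⟩ := ih hr.2 hW (by
        rw [List.getLast?_cons_of_ne_nil hW] at hlast
        exact hlast)
      cases c
      · by_cases hQ : Q = []
        · subst hQ
          refine ⟨[i], L, by simp [hQL], h1, h2, h3, fun _ p hp => ?_⟩
          obtain _ | ⟨q, L⟩ := L
          · simp at hp
          · cases hp
            intro h
            have h5 := head?_word (h3 p (by simp)).1
            have h6 : (p.1.headD 1, true) ∈ W.head? := by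
              rw [hQL]
              simp [List.head?_append, h5]
            exact Bool.false_ne_true (hr.1 _ h6 h)
        · refine ⟨Q ++ [i], L, by simp [hQL], h1, h2, h3, fun _ p hp => ?_⟩
          rw [headD_append hQ]
          exact h4 hQ p hp
      · by_cases hQ : Q = []
        · subst hQ
          obtain _ | ⟨⟨P, Q⟩, L⟩ := L
          · exact absurd (by simpa using hQL) hW
          · have hP : P ≠ [] := (h3 (P, Q) (by simp)).1
            refine ⟨[], (i :: P, Q) :: L, by simp [hQL, SegPair.word], ?_, ?_, ?_, by simp⟩
            · rw [List.isChain_cons] at h1 ⊢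
              exact h1
            · intro p hp
              rcases List.mem_cons.1 hp with rfl | hp
              · have := getLastD_append (S := [i]) hP
                rw [List.singleton_append] at this
                rw [this]
                exact h2 (P, Q) (by simp)
              · exact h2 p (by simp [hp])
            · intro p hp
              rcases List.mem_cons.1 hp with rfl | hp
              · exact ⟨by simp, (h3 (P, Q) (by simp)).2⟩
              · exact h3 p (by simp [hp])
        · refine ⟨[], ([i], Q) :: L, by simp [hQL, SegPair.word], ?_, ?_, ?_, by simp⟩
          · exact List.isChain_cons.2 ⟨h4 hQ, h1⟩
          · intro p hp
            rcases List.mem_cons.1 hp with rfl | hp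
            · intro h
              obtain rfl | ⟨Q, y, rfl⟩ := Q.eq_nil_or_concat'
              · exact hQ rfl
              · have h6 : (y, false) ∈ W.head? := by
                  rw [hQL]
                  simp
                have h7 : i = y := by simpa using h
                exact Bool.false_ne_true (hr.1 _ h6 h7).symm
            · exact h2 p (by simp [hp])
          · intro p hp
            rcases List.mem_cons.1 hp with rfl | hp
            · exact ⟨by simp, hQ⟩
            · exact h3 p hp

/-- A positive first letter leaves no room for an initial negative run in `exists_segments`, so the
whole word is cut into pairs. Cyclic reducedness supplies the condition from the last pair to the
first. -/
theorem exists_hasData_of_starts_ends {W : List (Fin 2 × Bool)}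
    (hr : FreeGroup.IsCyclicallyReduced W) {i j : Fin 2} (hhead : W.head? = some (i, true))
    (hlast : W.getLast? = some (j, false)) : ∃ s, HasData (FreeGroup.mk W) s := by
  have hne : W ≠ [] := by
    rintro rfl
    simp at hhead
  obtain ⟨Q, L, h, h1, h2, h3, -⟩ := exists_segments W hr.isReduced hne (by
    rw [hlast]
    rintro x ⟨⟩
    rfl)
  obtain rfl | ⟨Q, y, rfl⟩ := Q.eq_nil_or_concat'
  · rw [List.reverse_nil, List.map_nil, List.nil_append] at h
    have hL : L ≠ [] := by
      rintro rfl
      exact hne (by simpa using h)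
    refine ⟨_, .mixed L hL ⟨⟨h1, ?_⟩, h2⟩ h3 ?_⟩
    · intro p hp q hq hpq
      have e1 : W.getLast? = p.word.getLast? := by
        obtain rfl | ⟨L, p', rfl⟩ := L.eq_nil_or_concat'
        · exact absurd rfl hL
        · obtain rfl : p' = p := by simpa using hp
          have h := getLast?_word (h3 p' (by simp)).2
          subst_vars
          simp [List.getLast?_append, h]
      have e2 : W.head? = q.word.head? := by
        obtain _ | ⟨q', L⟩ := L
        · exact absurd rfl hL
        · obtain rfl : q' = q := by simpa using hq
          have h := head?_word (h3 q' (by simp)).1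
          subst_vars
          simp [List.head?_append, h]
      rw [getLast?_word (h3 p (List.mem_of_getLast? hp)).2] at e1
      rw [head?_word (h3 q (List.mem_of_head? hq)).1] at e2
      exact Bool.false_ne_true (hr.2 _ e1 _ e2 hpq)
    · rw [← mk_flatMap_word, h]
  · rw [h] at hhead
    simp at hhead

theorem isConj_mk_rotate (l m : List (Fin 2 × Bool)) :
    IsConj (FreeGroup.mk (m ++ l)) (FreeGroup.mk (l ++ m)) := by
  rw [isConj_iff]
  refine ⟨FreeGroup.mk l, ?_⟩
  rw [← FreeGroup.mul_mk, ← FreeGroup.mul_mk]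
  group

theorem isCyclicallyReduced_rotate {l m : List (Fin 2 × Bool)}
    (h : FreeGroup.IsCyclicallyReduced (l ++ m)) : FreeGroup.IsCyclicallyReduced (m ++ l) :=
  CycChain.rotate h

/-- Moving the initial run of negative letters to the end gives a word that begins positively and
ends negatively. -/
theorem exists_hasData_of_head_neg {W : List (Fin 2 × Bool)}
    (hr : FreeGroup.IsCyclicallyReduced W) {j : Fin 2} (hhead : W.head? = some (j, false))
    (hpos : ∃ i, (i, true) ∈ W) : ∃ s, HasData (FreeGroup.mk W) s := by
  have h := List.takeWhile_append_dropWhile (p := fun x : Fin 2 × Bool => !x.2) (l := W)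
  have h1 : ∀ x ∈ W.takeWhile (fun x => !x.2), x.2 = false := by
    intro x hx
    simpa using List.mem_takeWhile_imp hx
  have h2 : W.dropWhile (fun x => !x.2) ≠ [] := by
    obtain ⟨i, hi⟩ := hpos
    intro h2
    rw [h2, List.append_nil] at h
    rw [← h] at hi
    exact Bool.false_ne_true (h1 _ hi).symm
  have h3 : W.takeWhile (fun x => !x.2) ≠ [] := by
    obtain _ | ⟨x, W⟩ := W
    · simp at hhead
    · obtain rfl : x = (j, false) := by simpa using hhead
      simp
  have h4 := List.head_dropWhile_not (fun x : Fin 2 × Bool => !x.2) h2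
  rw [← h] at hr ⊢
  generalize W.takeWhile (fun x => !x.2) = N at *
  generalize W.dropWhile (fun x => !x.2) = D at *
  obtain _ | ⟨⟨i, c⟩, D⟩ := D
  · exact absurd rfl h2
  obtain rfl | ⟨N, ⟨k, d⟩, rfl⟩ := N.eq_nil_or_concat'
  · exact absurd rfl h3
  obtain rfl : c = true := by simpa using h4
  obtain rfl : d = false := h1 (k, d) (by simp)
  obtain ⟨s, hs⟩ := exists_hasData_of_starts_ends (isCyclicallyReduced_rotate hr) (i := i) (j := k)
    (by simp) (by simp [List.getLast?_append, List.getLast?_cons])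
  exact ⟨s, hs.congr (isConj_mk_rotate _ _)⟩

theorem exists_hasData {w : F2} (hw : w ≠ 1) : ∃ s, HasData w s := by
  set W := FreeGroup.reduceCyclically w.toWord with hW
  have hr : FreeGroup.IsCyclicallyReduced W :=
    FreeGroup.reduceCyclically.isCyclicallyReduced FreeGroup.isReduced_toWord
  have hconj : IsConj (FreeGroup.mk W) w := by
    have h1 := FreeGroup.reduceCyclically.conj_conjugator_reduceCyclically w.toWord
    rw [isConj_iff]
    refine ⟨FreeGroup.mk (FreeGroup.reduceCyclically.conjugator w.toWord), ?_⟩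
    rw [FreeGroup.inv_mk, FreeGroup.mul_mk, FreeGroup.mul_mk, h1, FreeGroup.mk_toWord]
  have hne : W ≠ [] := by
    have := cycLen_pos hw
    rw [cycLen, ← hW] at this
    exact List.length_pos_iff.1 this
  suffices ∃ s, HasData (FreeGroup.mk W) s by
    obtain ⟨s, hs⟩ := this
    exact ⟨s, hs.congr hconj⟩
  clear_value W
  by_cases hp : ∃ i, (i, true) ∈ W
  · by_cases hn : ∃ i, (i, false) ∈ W
    · obtain ⟨j, hj⟩ := hn
      obtain ⟨l, m, rfl⟩ := List.append_of_mem hj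
      obtain ⟨i, hi⟩ := hp
      obtain ⟨s, hs⟩ := exists_hasData_of_head_neg (isCyclicallyReduced_rotate hr) (j := j)
        (by simp) ⟨i, by simpa [or_comm, or_assoc, or_left_comm] using hi⟩
      exact ⟨s, hs.congr (isConj_mk_rotate _ _)⟩
    · have : W = (W.map Prod.fst).map fun i => (i, true) := by
        rw [List.map_map]
        refine (List.map_id W).symm.trans (List.map_congr_left fun x hx => ?_)
        obtain ⟨i, c⟩ := x
        cases c
        · exact absurd ⟨i, hx⟩ hn
        · rfl
      refine ⟨_, .pos (W.map Prod.fst) (by simpa using hne) ?_⟩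
      rw [pos, ← this]
  · have : W = ((W.map Prod.fst).reverse.reverse).map fun i => (i, false) := by
      rw [List.reverse_reverse, List.map_map]
      refine (List.map_id W).symm.trans (List.map_congr_left fun x hx => ?_)
      obtain ⟨i, c⟩ := x
      cases c
      · rfl
      · exact absurd ⟨i, hx⟩ hp
    refine ⟨_, .neg (W.map Prod.fst).reverse (by simpa using hne) ?_⟩
    have h2 : (pos (W.map Prod.fst).reverse)⁻¹ = FreeGroup.mk W := by
      conv_rhs => rw [this]
      rw [pos, FreeGroup.inv_mk, FreeGroup.invRev]
      simp [Function.comp_def]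
    rw [h2]

/-! ### Tame data and slopes along positive chains -/

/-- `σ` for `true` and `τ` for `false`. -/
def gen (c : Bool) : MulAut F2 := if c then sigma else tau

/-- The composition of the automorphisms `gen c`, the last one in the list being applied first. -/
def act (W : List Bool) : MulAut F2 := (W.map gen).prod

@[simp] theorem act_nil : act [] = 1 := rfl

theorem act_cons (c : Bool) (W : List Bool) : act (c :: W) = gen c * act W := by simp [act]

theorem act_append (V W : List Bool) : act (V ++ W) = act V * act W := by simp [act]

theorem act_replicate (n : ℕ) (c : Bool) : act (List.replicate n c) = gen c ^ n := by
  simp [act, List.prod_replicate]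

/-- The data of a cyclic word, with `a` and `b` exchanged for `c = false`. -/
def SegData.view (c : Bool) (s : SegData) : SegData := if c then s else s.swap

theorem HasData.gen {w : F2} {s : SegData} (h : HasData w s) (c : Bool) :
    ∃ s', HasData (gen c w) s' ∧ SigmaStep (s.view c) (s'.view c) := by
  cases c
  · obtain ⟨s', h1, h2⟩ := h.swap.sigma
    refine ⟨s'.swap, ?_, h2⟩
    have h3 := h1.swap
    rwa [← MulAut.mul_apply, ← MulAut.mul_apply, swapAut_sigma_swapAut] at h3
  · exact h.sigma

/-- No segment of the cyclic word disappears under `gen c`, and all the pure segments of the other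
letter have length one. -/
def SegData.Tame (c : Bool) (s : SegData) : Prop :=
  (s.view c).db = 0 ∧ (s.view c).ba = (s.view c).da

/-- The rate of growth of the length of a cyclic word under the powers of `gen c`, provided that
its data are tame. -/
def SegData.slope (c : Bool) (s : SegData) : ℕ :=
  (s.view c).na + 2 * (s.view c).db - 2 * (s.view c).t

/-- If the same generator is applied again, no segment vanishes. If the other one is applied, all
pure segments of the letter it multiplies by have length one and vanish at once; the term 2`db` in
`slope` anticipates this drop in t. The slopes thus obey a linear rule independent of the word. -/
theorem SegData.Tame.step {w w' : F2} {s s' : SegData} (hs : HasData w s) (hs' : HasData w' s')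
    {c c' : Bool} (h : s.Tame c) (hstep : SigmaStep (s.view c') (s'.view c')) :
    s'.Tame c' ∧ s'.t ≤ s.t ∧ s'.slope c' = s.slope c' ∧
      s'.slope (!c') = s.slope c' + s.slope (!c') := by
  have h1 := hs.invariants
  have h2 := hs'.invariants
  obtain ⟨h3, h4, h5, h6, e, h7, h8, h9, h10⟩ := hstep
  cases c <;> cases c' <;>
    simp only [SegData.Tame, SegData.slope, SegData.view, SegData.swap, Bool.not_true,
      Bool.not_false, if_true, if_false, Bool.false_eq_true] at * <;> omega

/-- Since `da` + `db` is at most 2t, the length lies between the sum of the slopes and that sum plus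
4t. -/
theorem HasData.slope_sum {w : F2} {s : SegData} (h : HasData w s) :
    s.slope true + s.slope false + 4 * s.t = cycLen w + 2 * s.da + 2 * s.db := by
  have h1 := h.invariants
  rw [h.cycLen_eq]
  simp only [SegData.slope, SegData.view, SegData.swap, if_true, if_false, Bool.false_eq_true]
  omega

/-- After sufficiently many steps the data are tame. -/
theorem HasData.act {u : F2} {s₀ : SegData} (h : HasData u s₀) (W : List Bool) :
    ∃ s, HasData (act W u) s ∧ s.ba + s.bb ≤ s₀.ba + s₀.bb ∧
      (s.ba + s.bb + W.length ≤ s₀.ba + s₀.bb ∨ ∃ c W', W = c :: W' ∧ s.Tame c) := by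
  induction W with
  | nil => exact ⟨s₀, h, le_rfl, .inl le_rfl⟩
  | cons c W ih =>
    obtain ⟨s, h1, h2, h3⟩ := ih
    obtain ⟨s', h4, h5⟩ := h1.gen c
    rw [act_cons, MulAut.mul_apply]
    have i1 := h1.invariants
    have i2 := h4.invariants
    refine ⟨s', h4, ?_, ?_⟩
    · obtain ⟨-, -, h7, h8, -⟩ := h5
      cases c <;>
        simp only [SegData.view, SegData.swap, if_true, if_false, Bool.false_eq_true] at h7 h8 <;>
        omega
    · rcases h3 with h3 | ⟨c', W', -, h3⟩
      -- If no pure segment of the multiplying letter is present, nothing vanishes and the result is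
      -- tame. Otherwise each such segment loses a letter, and the potential `ba` + `bb` drops.
      · by_cases hd : (s.view c).db = 0
        · right
          refine ⟨c, W, rfl, ?_⟩
          obtain ⟨-, -, h7, h8, e, -, h9, -, h10⟩ := h5
          have h11 := h10 (by omega)
          cases c <;>
            simp only [SegData.Tame, SegData.view, SegData.swap, if_true, if_false,
              Bool.false_eq_true] at * <;>
            omega
        · left
          obtain ⟨-, -, h7, h8, -⟩ := h5
          rw [List.length_cons]
          cases c <;>
            simp only [SegData.view, SegData.swap, if_true, if_false, Bool.false_eq_true] at * <;>
            omega
      · exact .inr ⟨c, W, rfl, (h3.step h1 h4 h5).1⟩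

theorem HasData.act_tame {u : F2} {s₀ : SegData} (h : HasData u s₀) {c : Bool} {W : List Bool}
    (hW : cycLen u ≤ W.length) : ∃ s, HasData (F2.act (c :: W) u) s ∧ s.Tame c := by
  obtain ⟨s, h1, -, h2⟩ := h.act (c :: W)
  refine ⟨s, h1, ?_⟩
  rcases h2 with h2 | ⟨c', W', h2, h3⟩
  · have := h.invariants
    rw [h.cycLen_eq] at hW
    rw [List.length_cons] at h2
    omega
  · cases h2
    exact h3

/-- The length does not change when `gen c` is applied to `gen c ^ k w`. -/
def Stable (k : ℕ) (c : Bool) (w : F2) : Prop :=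
  cycLen ((gen c ^ (k + 1)) w) = cycLen ((gen c ^ k) w)

theorem HasData.cycLen_gen {w : F2} {s : SegData} (h : HasData w s) (c : Bool) :
    cycLen (F2.gen c w) + 2 * s.t = cycLen w + (s.view c).na := by
  obtain ⟨s', h1, h2, h3, -⟩ := h.gen c
  rw [h1.cycLen_eq, h.cycLen_eq]
  cases c <;>
    simp only [SegData.view, SegData.swap, if_true, if_false, Bool.false_eq_true] at * <;>
    omega

/-- One application of `gen c` makes the data tame for c, after which the slope is the exact
increment of the length and stays constant. This is why k must be nonzero. -/
theorem stable_iff_slope {w : F2} {s : SegData} (h : HasData w s) {c₀ : Bool} (ht : s.Tame c₀)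
    {k : ℕ} (hk : k ≠ 0) (c : Bool) : Stable k c w ↔ s.slope c = 0 := by
  obtain ⟨k, rfl⟩ := Nat.exists_eq_succ_of_ne_zero hk
  have key : ∀ j, ∃ s', HasData ((gen c ^ (j + 1)) w) s' ∧ s'.Tame c ∧ s'.slope c = s.slope c := by
    intro j
    induction j with
    | zero =>
      obtain ⟨s', h1, h2⟩ := h.gen c
      have h3 := ht.step h h1 h2
      exact ⟨s', by simpa using h1, h3.1, h3.2.2.1⟩
    | succ j ih =>
      obtain ⟨s₁, h1, h2, h3⟩ := ih
      obtain ⟨s', h4, h5⟩ := h1.gen c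
      have h6 := h2.step h1 h4 h5
      refine ⟨s', ?_, h6.1, h6.2.2.1.trans h3⟩
      rwa [pow_succ', MulAut.mul_apply]
  obtain ⟨s', h1, h2, h3⟩ := key k
  have h4 := h1.cycLen_gen c
  have h5 := h1.invariants
  rw [Stable, pow_succ', MulAut.mul_apply, ← h3]
  simp only [SegData.Tame, SegData.slope] at h2 ⊢
  have h6 : (s'.view c).t = s'.t := by cases c <;> rfl
  have h7 : 2 * (s'.view c).t ≤ (s'.view c).na + (s'.view c).db := by
    cases c <;>
      simp only [SegData.view, SegData.swap, if_true, if_false, Bool.false_eq_true] at * <;>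
      omega
  rw [Nat.succ_eq_add_one]
  omega

/-- The length grows linearly under high powers of `gen c`. -/
theorem HasData.linear_growth {w : F2} {s : SegData} (h : HasData w s) (c : Bool) {n : ℕ}
    (hn : s.ba + s.bb ≤ n) :
    ∃ p, ∀ j, cycLen ((F2.gen c ^ (n + j)) w) = cycLen ((F2.gen c ^ n) w) + j * p := by
  -- Each application lowers the pure length of the multiplying letter by at least one until it is
  -- zero. From then on nothing vanishes, so t and the increment are constant.
  have h1 : ∀ n, ∃ s', HasData ((F2.gen c ^ n) w) s' ∧
      ((s'.view c).bb + n ≤ (s.view c).bb ∨ (s'.view c).bb = 0) := by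
    intro n
    induction n with
    | zero => exact ⟨s, by simpa using h, .inl le_rfl⟩
    | succ n ih =>
      obtain ⟨s₁, h1, h2⟩ := ih
      obtain ⟨s', h3, -, -, h4, -⟩ := h1.gen c
      have h5 := h1.invariants
      refine ⟨s', ?_, ?_⟩
      · rwa [pow_succ', MulAut.mul_apply]
      · cases c <;>
          simp only [SegData.view, SegData.swap, if_true, if_false, Bool.false_eq_true] at * <;>
          omega
  obtain ⟨s₁, h2, h3⟩ := h1 n
  have h4 : (s₁.view c).bb = 0 := by
    cases c <;>
      simp only [SegData.view, SegData.swap, if_true, if_false, Bool.false_eq_true] at * <;>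
      omega
  have h5 : ∀ j, ∃ s', HasData ((F2.gen c ^ (n + j)) w) s' ∧ (s'.view c).bb = 0 ∧
      (s'.view c).na = (s₁.view c).na ∧ s'.t = s₁.t ∧
      cycLen ((F2.gen c ^ (n + j)) w) + j * (2 * s₁.t) =
        cycLen ((F2.gen c ^ n) w) + j * (s₁.view c).na := by
    intro j
    induction j with
    | zero => exact ⟨s₁, h2, h4, rfl, rfl, by simp⟩
    | succ j ih =>
      obtain ⟨s₂, i1, i2, i3, i4, i5⟩ := ih
      obtain ⟨s', i6, i7, -, i9, -, e, i10, i11, -⟩ := i1.gen c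
      have i12 := i1.cycLen_gen c
      have i13 := i1.invariants
      have i14 : (s₂.view c).db = 0 := by
        cases c <;>
          simp only [SegData.view, SegData.swap, if_true, if_false, Bool.false_eq_true] at * <;>
          omega
      have i15 : s₂.t = (s₂.view c).t := by cases c <;> rfl
      have i16 : s'.t = (s'.view c).t := by cases c <;> rfl
      rw [show n + (j + 1) = (n + j) + 1 by ring, pow_succ', MulAut.mul_apply]
      refine ⟨s', i6, by omega, by omega, by omega, ?_⟩
      rw [add_mul, add_mul, one_mul, one_mul]
      omega
  refine ⟨(s₁.view c).na - 2 * s₁.t, fun j => ?_⟩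
  obtain ⟨-, -, -, -, -, h6⟩ := h5 j
  have h7 := h2.invariants
  have h8 : 2 * s₁.t ≤ (s₁.view c).na := by
    cases c <;>
      simp only [SegData.view, SegData.swap, if_true, if_false, Bool.false_eq_true] at * <;>
      omega
  rw [Nat.mul_sub]
  have h9 := Nat.mul_le_mul_left j h8
  omega

/-! ### Domination along positive chains and vanishing of slopes -/

/-- The lengths of the images of `u` under positive chains are bounded by a multiple of those
of `v`. -/
def ChainDominated (u v : F2) : Prop :=
  ∃ C : ℕ, ∀ W, cycLen (act W u) ≤ C * cycLen (act W v)

/-- Beyond exponent k both lengths grow linearly in the exponent. If the rate of v is zero,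
domination bounds the length of u, so its rate is zero as well. -/
theorem ChainDominated.stable {u v : F2} (h : ChainDominated u v) (hu : u ≠ 1) (hv : v ≠ 1)
    {k : ℕ} (hku : cycLen u ≤ k) (hkv : cycLen v ≤ k) (W : List Bool) (c : Bool)
    (hs : Stable k c (act W v)) : Stable k c (act W u) := by
  have key : ∀ x, x ≠ 1 → cycLen x ≤ k → ∃ p, ∀ j,
      cycLen ((gen c ^ (k + j)) (act W x)) = cycLen ((gen c ^ k) (act W x)) + j * p := by
    intro x hx hkx
    obtain ⟨s₀, h0⟩ := exists_hasData hx
    obtain ⟨s, h1, h2, -⟩ := h0.act W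
    have h3 := h0.invariants
    rw [h0.cycLen_eq] at hkx
    exact h1.linear_growth c (by omega)
  obtain ⟨p, hp⟩ := key u hu hku
  obtain ⟨q, hq⟩ := key v hv hkv
  obtain ⟨C, hC⟩ := h
  have hq0 : q = 0 := by
    have := hq 1
    rw [Stable] at hs
    omega
  subst hq0
  have hp0 : p = 0 := by
    by_contra hp0
    set M := C * cycLen ((gen c ^ k) (act W v)) with hM
    have h1 := hC (List.replicate (k + (M + 1)) c ++ W)
    rw [act_append, act_replicate, MulAut.mul_apply, MulAut.mul_apply, hp, hq, mul_zero, add_zero,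
      ← hM] at h1
    have h2 : M + 1 ≤ (M + 1) * p := Nat.le_mul_of_pos_right _ (Nat.pos_of_ne_zero hp0)
    omega
  rw [Stable, hp 1, hp0, mul_zero, add_zero]

/-- The slopes of u and v are updated by the same additions, so a bound by K persists. The length of
u is at most the sum of its slopes plus 4K, and the length of v is at least one and at least the sum
of its slopes; hence the factor 5K. -/
theorem dominated_of_tame {u v : F2} {su sv : SegData} (hu : HasData u su) (hv : HasData v sv)
    {c : Bool} (htu : su.Tame c) (htv : sv.Tame c) {K : ℕ} (ht : su.t ≤ K)
    (hK : ∀ c, su.slope c ≤ K * sv.slope c) (W : List Bool) :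
    cycLen (act W u) ≤ 5 * K * cycLen (act W v) := by
  have key : ∃ su sv c, HasData (act W u) su ∧ HasData (act W v) sv ∧ su.Tame c ∧ sv.Tame c ∧
      su.t ≤ K ∧ ∀ c, su.slope c ≤ K * sv.slope c := by
    induction W with
    | nil => exact ⟨su, sv, c, hu, hv, htu, htv, ht, hK⟩
    | cons c' W ih =>
      obtain ⟨su, sv, c, hu, hv, htu, htv, ht, hK⟩ := ih
      obtain ⟨su', hu', hsu⟩ := hu.gen c'
      obtain ⟨sv', hv', hsv⟩ := hv.gen c'
      have h1 := htu.step hu hu' hsu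
      have h2 := htv.step hv hv' hsv
      rw [act_cons, MulAut.mul_apply, MulAut.mul_apply]
      refine ⟨su', sv', c', hu', hv', h1.1, h2.1, h1.2.1.trans ht, fun d => ?_⟩
      by_cases hd : d = c'
      · rw [hd, h1.2.2.1, h2.2.2.1]
        exact hK c'
      · rw [show d = !c' by revert hd; cases d <;> cases c' <;> decide, h1.2.2.2, h2.2.2.2, mul_add]
        exact Nat.add_le_add (hK _) (hK _)
  obtain ⟨su, sv, c, hu, hv, -, -, ht, hK⟩ := key
  have h1 := hu.slope_sum
  have h2 := hv.slope_sum
  have h3 := hv.invariants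
  have h4 : 1 ≤ cycLen (act W v) := by
    rw [Nat.one_le_iff_ne_zero]
    intro h0
    rw [cycLen_eq_zero] at h0
    rw [h0] at hv
    have h5 := hv.cycLen_eq
    rw [cycLen_one] at h5
    cases hv with
    | pos S hS h =>
      simp only [posData] at h5
      have := count_add_count S
      have := List.length_pos_iff.2 hS
      omega
    | neg S hS h =>
      simp only [posData] at h5
      have := count_add_count S
      have := List.length_pos_iff.2 hS
      omega
    | mixed L hL hw hne h =>
      have := List.length_pos_iff.2 hL
      simp only [segData] at h5 h3
      omega
  have h5 : sv.slope true + sv.slope false ≤ cycLen (act W v) := by omega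
  calc cycLen (act W u) ≤ su.slope true + su.slope false + 4 * K := by omega
    _ ≤ K * sv.slope true + K * sv.slope false + 4 * K := by
      have := hK true
      have := hK false
      omega
    _ = K * (sv.slope true + sv.slope false) + 4 * K * 1 := by ring
    _ ≤ K * cycLen (act W v) + 4 * K * cycLen (act W v) := by gcongr
    _ = _ := by ring

/-- A chain of length at least N factors through its first N steps, after which both words are tame
and stability compares the zeros of the slopes. There are finitely many such beginnings, and
finitely many shorter chains. -/
theorem chainDominated_of_stable {u v : F2} (hu : u ≠ 1) (hv : v ≠ 1) {N k : ℕ}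
    (hNu : cycLen u < N) (hNv : cycLen v < N) (hk : k ≠ 0)
    (h : ∀ W : List Bool, W.length = N → ∀ c, Stable k c (act W v) → Stable k c (act W u)) :
    ChainDominated u v := by
  obtain ⟨su₀, hsu₀⟩ := exists_hasData hu
  obtain ⟨sv₀, hsv₀⟩ := exists_hasData hv
  have hlong : ∀ W₀ : List Bool, ∃ C : ℕ, W₀.length = N →
      ∀ W, cycLen (act (W ++ W₀) u) ≤ C * cycLen (act (W ++ W₀) v) := by
    intro W₀
    by_cases hW₀ : W₀.length = N
    · obtain _ | ⟨c, W₀⟩ := W₀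
      · simp at hW₀
        omega
      · obtain ⟨su, h1, h2⟩ := hsu₀.act_tame (c := c) (W := W₀) (by simp at hW₀; omega)
        obtain ⟨sv, h3, h4⟩ := hsv₀.act_tame (c := c) (W := W₀) (by simp at hW₀; omega)
        have h5 := h _ hW₀
        -- This K works because a slope of v is either zero, forcing that of u to be zero, or at
        -- least one.
        set K := su.t + su.slope true + su.slope false with hK
        refine ⟨5 * K, fun _ W => ?_⟩
        rw [act_append, MulAut.mul_apply, MulAut.mul_apply]
        refine dominated_of_tame h1 h3 h2 h4 (by omega) (fun d => ?_) W
        have h6 := h5 d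
        rw [stable_iff_slope h1 h2 hk, stable_iff_slope h3 h4 hk] at h6
        by_cases h7 : sv.slope d = 0
        · rw [h6 h7]
          exact Nat.zero_le _
        · refine le_trans ?_ (Nat.le_mul_of_pos_right K (Nat.pos_of_ne_zero h7))
          cases d <;> omega
    · exact ⟨0, fun h => absurd h hW₀⟩
  choose C hC using hlong
  obtain ⟨M, hM⟩ := ((List.finite_length_eq Bool N).image C).bddAbove
  obtain ⟨M', hM'⟩ := ((List.finite_length_le Bool N).image fun W => cycLen (act W u)).bddAbove
  refine ⟨M + M', fun W => ?_⟩
  by_cases hW : N ≤ W.length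
  · have h1 : W = W.take (W.length - N) ++ W.drop (W.length - N) := (List.take_append_drop _ _).symm
    have h2 : (W.drop (W.length - N)).length = N := by
      rw [List.length_drop]
      omega
    have h3 := hC _ h2 (W.take (W.length - N))
    rw [← h1] at h3
    refine h3.trans (Nat.mul_le_mul_right _ ?_)
    exact (hM ⟨_, h2, rfl⟩).trans (Nat.le_add_right _ _)
  · have h1 : cycLen (act W u) ≤ M' := hM' ⟨W, by simp; omega, rfl⟩
    have h2 : 0 < cycLen (act W v) := cycLen_pos (by simpa using hv)
    calc cycLen (act W u) ≤ M' := h1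
      _ ≤ M + M' := Nat.le_add_left _ _
      _ ≤ _ := Nat.le_mul_of_pos_right _ h2

/-! ### Common prefixes and distances in the Cayley tree -/

/-- The length of the longest common prefix. -/
def lcp {α : Type*} [DecidableEq α] : List α → List α → ℕ
  | x :: A, y :: B => if x = y then lcp A B + 1 else 0
  | _, _ => 0

theorem min_lcp_le {α : Type*} [DecidableEq α] (A B C : List α) :
    min (lcp A B) (lcp B C) ≤ lcp A C := by
  induction A generalizing B C with
  | nil => simp [lcp]
  | cons x A ih =>
    obtain _ | ⟨y, B⟩ := B
    · simp [lcp]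
    obtain _ | ⟨z, C⟩ := C
    · simp [lcp]
    have := ih B C
    simp only [lcp]
    split_ifs with h1 h2 h3
    · omega
    · exact absurd (h1.trans h2) h3
    all_goals simp

theorem take_lcp {α : Type*} [DecidableEq α] (A B : List α) :
    A.take (lcp A B) = B.take (lcp A B) := by
  induction A generalizing B with
  | nil => simp [lcp]
  | cons x A ih =>
    obtain _ | ⟨y, B⟩ := B
    · simp [lcp]
    simp only [lcp]
    split_ifs with h
    · rw [List.take_succ_cons, List.take_succ_cons, ih B, h]
    · rfl

theorem lcp_comm {α : Type*} [DecidableEq α] (A B : List α) : lcp A B = lcp B A := by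
  induction A generalizing B with
  | nil => cases B <;> simp [lcp]
  | cons x A ih =>
    obtain _ | ⟨y, B⟩ := B
    · simp [lcp]
    simp only [lcp, ih B, eq_comm]

theorem norm_inv_mul_mk (A B : List (Fin 2 × Bool)) (hA : FreeGroup.IsReduced A)
    (hB : FreeGroup.IsReduced B) :
    ((FreeGroup.mk A)⁻¹ * FreeGroup.mk B).norm + 2 * lcp A B = A.length + B.length := by
  have hnorm : ∀ {C : List (Fin 2 × Bool)}, FreeGroup.IsReduced C →
      (FreeGroup.mk C).norm = C.length := by
    intro C hC
    rw [FreeGroup.norm, FreeGroup.toWord_mk, hC.reduce_eq]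
  induction A generalizing B with
  | nil =>
    rw [← FreeGroup.one_eq_mk, inv_one, one_mul, hnorm hB]
    simp [lcp]
  | cons x A ih =>
    obtain _ | ⟨y, B⟩ := B
    · rw [← FreeGroup.one_eq_mk, mul_one, FreeGroup.norm_inv_eq, hnorm hA]
      simp [lcp]
    simp only [lcp]
    split_ifs with h
    · subst h
      have h1 := ih B (List.isChain_cons.1 hA).2 (List.isChain_cons.1 hB).2
      have h2 : (FreeGroup.mk (x :: A))⁻¹ * FreeGroup.mk (x :: B) =
          (FreeGroup.mk A)⁻¹ * FreeGroup.mk B := by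
        rw [← List.singleton_append, ← List.singleton_append (l := B), ← FreeGroup.mul_mk,
          ← FreeGroup.mul_mk]
        group
      rw [h2, List.length_cons, List.length_cons]
      omega
    · have h1 : FreeGroup.IsReduced (FreeGroup.invRev (x :: A) ++ y :: B) := by
        refine List.isChain_append.2 ⟨?_, hB, ?_⟩
        · have h2 := FreeGroup.isReduced_toWord (x := (FreeGroup.mk (x :: A))⁻¹)
          rwa [FreeGroup.toWord_inv, FreeGroup.toWord_mk, hA.reduce_eq] at h2
        · intro z hz w hw h2
          obtain rfl : y = w := by simpa using hw
          obtain rfl : (x.1, !x.2) = z := by simpa [FreeGroup.invRev] using hz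
          by_contra h3
          refine h (Prod.ext h2 ?_)
          revert h3
          change ¬ (!x.2) = y.2 → _
          cases x.2 <;> cases y.2 <;> decide
      rw [FreeGroup.inv_mk, FreeGroup.mul_mk, hnorm h1, List.length_append,
        FreeGroup.invRev_length]
      omega

/-- The common prefix length is the Gromov product of x and y at the identity; `min_lcp_le` is the
ultrametric inequality it satisfies in a tree. -/
theorem norm_inv_mul (x y : F2) :
    (x⁻¹ * y).norm + 2 * lcp x.toWord y.toWord = x.norm + y.norm := by
  have := norm_inv_mul_mk x.toWord y.toWord FreeGroup.isReduced_toWord FreeGroup.isReduced_toWord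
  rwa [FreeGroup.mk_toWord, FreeGroup.mk_toWord] at this

theorem norm_mul_add (x y : F2) :
    (x * y).norm + 2 * lcp x⁻¹.toWord y.toWord = x.norm + y.norm := by
  have := norm_inv_mul x⁻¹ y
  rwa [inv_inv, FreeGroup.norm_inv_eq] at this

/-- The four point condition in the Cayley tree. -/
theorem norm_four_point {g v w : F2} (h : g.norm + w.norm < (g * v).norm + (v * w).norm) :
    (g * v * w).norm + v.norm = (g * v).norm + (v * w).norm := by
  have h1 := norm_inv_mul g (g * v)
  have h2 := norm_inv_mul (g * v) (g * v * w)
  have h3 := norm_inv_mul g (g * v * w)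
  rw [show g⁻¹ * (g * v) = v by group] at h1
  rw [show (g * v)⁻¹ * (g * v * w) = w by group] at h2
  rw [show g⁻¹ * (g * v * w) = v * w by group] at h3
  -- Of the three sums of opposite distances between 1, g, gv, gvw the two largest agree. The
  -- hypothesis says that |g| + |w| is not among them.
  have h4 := min_lcp_le g.toWord (g * v).toWord (g * v * w).toWord
  have h5 := min_lcp_le g.toWord (g * v * w).toWord (g * v).toWord
  rw [lcp_comm (g * v * w).toWord] at h5
  rcases min_le_iff.1 h4 with h6 | h6 <;> rcases min_le_iff.1 h5 with h7 | h7 <;> omega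

/-! ### Nielsen reduced pairs -/

/-- The image of a letter. -/
def img (φ : MulAut F2) (l : Fin 2 × Bool) : F2 := φ (FreeGroup.mk [l])

theorem img_inv (φ : MulAut F2) (i : Fin 2) (c : Bool) : img φ (i, !c) = (img φ (i, c))⁻¹ := by
  rw [img, img, ← map_inv, FreeGroup.inv_mk]
  rfl

/-- The two letters do not cancel. -/
def NoCancel (l m : Fin 2 × Bool) : Prop := l.1 = m.1 → l.2 = m.2

/-- The pair of images of the basis elements is Nielsen reduced. -/
def NielsenReduced (φ : MulAut F2) : Prop :=
  (∀ l m, NoCancel l m → (img φ l).norm ≤ (img φ l * img φ m).norm) ∧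
    ∀ l m n, NoCancel l m → NoCancel m n →
      (img φ l).norm + (img φ n).norm < (img φ l * img φ m).norm + (img φ m * img φ n).norm

theorem map_mk_cons (φ : MulAut F2) (l : Fin 2 × Bool) (W : List (Fin 2 × Bool)) :
    φ (FreeGroup.mk (l :: W)) = img φ l * φ (FreeGroup.mk W) := by
  rw [img, ← map_mul, FreeGroup.mul_mk, List.singleton_append]

theorem img_ne_one (φ : MulAut F2) (l : Fin 2 × Bool) : img φ l ≠ 1 := by
  rw [img, ne_eq, EmbeddingLike.map_eq_one_iff]
  obtain ⟨i, c⟩ := l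
  cases c
  · exact fun h => FreeGroup.of_ne_one i (inv_eq_one.1 h)
  · exact FreeGroup.of_ne_one i

theorem NielsenReduced.norm_le_right {φ : MulAut F2} (h : NielsenReduced φ) {l m : Fin 2 × Bool}
    (hlm : NoCancel l m) : (img φ m).norm ≤ (img φ l * img φ m).norm := by
  obtain ⟨i, c⟩ := l
  obtain ⟨j, d⟩ := m
  have := h.1 (j, !d) (i, !c) (fun hij => by
    have := hlm hij.symm
    simpa using this.symm)
  rwa [img_inv, img_inv, ← mul_inv_rev, FreeGroup.norm_inv_eq, FreeGroup.norm_inv_eq] at this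

/-- At most half of either factor cancels, and both factors are nontrivial. -/
theorem NielsenReduced.two_le_norm_mul {φ : MulAut F2} (h : NielsenReduced φ) {l m : Fin 2 × Bool}
    (hlm : NoCancel l m) : 2 ≤ (img φ l * img φ m).norm := by
  have h1 := h.1 l m hlm
  have h2 := h.norm_le_right hlm
  have h3 := norm_mul_add (img φ l) (img φ m)
  have h4 : (img φ l).norm ≠ 0 := by
    rw [ne_eq, FreeGroup.norm_eq_zero]
    exact img_ne_one φ l
  have h5 : (img φ m).norm ≠ 0 := by
    rw [ne_eq, FreeGroup.norm_eq_zero]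
    exact img_ne_one φ m
  omega

/-- For a Nielsen reduced pair, appending a letter changes the length as it does for the last
letter alone, so that lengths do not decrease. -/
theorem NielsenReduced.two_le_norm {φ : MulAut F2} (h : NielsenReduced φ)
    (W : List (Fin 2 × Bool)) : ∀ l m, FreeGroup.IsReduced (W ++ [l, m]) →
      (φ (FreeGroup.mk (W ++ [l, m]))).norm + (img φ l).norm =
        (φ (FreeGroup.mk (W ++ [l]))).norm + (img φ l * img φ m).norm ∧
      2 ≤ (φ (FreeGroup.mk (W ++ [l, m]))).norm := by
  have happ : ∀ (V : List (Fin 2 × Bool)) (l : Fin 2 × Bool),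
      φ (FreeGroup.mk (V ++ [l])) = φ (FreeGroup.mk V) * img φ l := by
    intro V l
    rw [img, ← map_mul, FreeGroup.mul_mk]
  induction W using List.reverseRecOn with
  | nil =>
    intro l m hr
    have hlm : NoCancel l m := by
      have := List.isChain_cons_cons.1 hr
      exact this.1
    rw [List.nil_append, List.nil_append, map_mk_cons, ← img, ← img]
    exact ⟨by omega, h.two_le_norm_mul hlm⟩
  | append_singleton W k ih =>
    intro l m hr
    have hr' : FreeGroup.IsReduced (W ++ [k, l]) := by
      refine hr.infix ⟨[], [m], ?_⟩
      simp
    have hkl : NoCancel k l := by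
      have : FreeGroup.IsReduced [k, l] := hr'.infix ⟨W, [], by simp⟩
      exact (List.isChain_cons_cons.1 this).1
    have hlm : NoCancel l m := by
      have : FreeGroup.IsReduced [l, m] := hr.infix ⟨W ++ [k], [], by simp⟩
      exact (List.isChain_cons_cons.1 this).1
    obtain ⟨h1, h2⟩ := ih k l hr'
    have h3 := h.2 k l m hkl hlm
    have h4 := h.1 l m hlm
    have e1 : φ (FreeGroup.mk (W ++ [k, l])) = φ (FreeGroup.mk (W ++ [k])) * img φ l := by
      rw [← happ]
      simp
    have e2 : φ (FreeGroup.mk (W ++ [k] ++ [l])) = φ (FreeGroup.mk (W ++ [k])) * img φ l :=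
      happ _ _
    have e3 : φ (FreeGroup.mk (W ++ [k] ++ [l, m])) =
        φ (FreeGroup.mk (W ++ [k])) * img φ l * img φ m := by
      rw [← e2, ← happ]
      simp
    rw [e1] at h1 h2
    rw [e2, e3]
    -- The induction hypothesis replaces the whole prefix by its last letter k, so the hypothesis of
    -- the four point lemma is the second Nielsen condition for k, l, m.
    have h5 := norm_four_point (g := φ (FreeGroup.mk (W ++ [k]))) (v := img φ l) (w := img φ m)
      (by omega)
    exact ⟨h5, by omega⟩

theorem NielsenReduced.exists_img_eq {φ : MulAut F2} (h : NielsenReduced φ) {x : F2}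
    (hx : x.norm = 1) : ∃ l, img φ l = x := by
  obtain ⟨w, rfl⟩ := φ.surjective x
  have hr := FreeGroup.isReduced_toWord (x := w)
  have hw := FreeGroup.mk_toWord (x := w)
  generalize w.toWord = W at hr hw
  subst hw
  obtain rfl | ⟨W, m, rfl⟩ := W.eq_nil_or_concat'
  · rw [← FreeGroup.one_eq_mk, map_one, FreeGroup.norm_one] at hx
    omega
  · obtain rfl | ⟨W, l, rfl⟩ := W.eq_nil_or_concat'
    · exact ⟨m, rfl⟩
    · have h2 := (h.two_le_norm W l m (by simpa using hr)).2
      rw [show W ++ [l] ++ [m] = W ++ [l, m] by simp] at hx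
      omega

/-- The elements a and b have norm one, so they are images of letters; these have different bases,
hence φ permutes the letters and their inverses and is an isometry. -/
theorem NielsenReduced.cycLen_eq {φ : MulAut F2} (h : NielsenReduced φ) (w : F2) :
    cycLen (φ w) = cycLen w := by
  obtain ⟨⟨i, c⟩, hl⟩ := h.exists_img_eq (x := a) rfl
  obtain ⟨⟨j, d⟩, hm⟩ := h.exists_img_eq (x := b) rfl
  have hof : ∀ i c, φ (FreeGroup.of i) = img φ (i, c) ∨ φ (FreeGroup.of i) = (img φ (i, c))⁻¹ := by
    intro i c
    cases c
    · right
      rw [← img_inv]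
      rfl
    · exact .inl rfl
  have hi : (φ (FreeGroup.of i)).norm ≤ 1 := by
    rcases hof i c with h1 | h1
    · rw [h1, hl]; rfl
    · rw [h1, hl, FreeGroup.norm_inv_eq]; rfl
  have hj : (φ (FreeGroup.of j)).norm ≤ 1 := by
    rcases hof j d with h1 | h1
    · rw [h1, hm]; rfl
    · rw [h1, hm, FreeGroup.norm_inv_eq]; rfl
  have hij : i ≠ j := by
    rintro rfl
    have hab : a ≠ b ∧ a ≠ b⁻¹ := by
      refine ⟨?_, ?_⟩ <;> intro hab <;> have := congrArg FreeGroup.toWord hab <;> revert this <;>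
        decide
    by_cases hcd : c = d
    · subst hcd
      exact hab.1 (hl.symm.trans hm)
    · have hcd' : c = !d := by revert hcd; cases c <;> cases d <;> decide
      rw [hcd', img_inv, hm] at hl
      exact hab.2 hl.symm
  have h1 : ∀ k, (φ (FreeGroup.of k)).norm ≤ 1 := by
    intro k
    have := (by decide : ∀ i j k : Fin 2, i ≠ j → k = i ∨ k = j) i j k hij
    rcases this with rfl | rfl
    · exact hi
    · exact hj
  have h2 : ∀ k, (φ⁻¹ (FreeGroup.of k)).norm ≤ 1 := by
    intro k
    rcases eq_zero_or_one k with rfl | rfl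
    · change (φ⁻¹ a).norm ≤ 1
      rw [← hl, img, MulAut.inv_apply_self]
      exact FreeGroup.norm_mk_le
    · change (φ⁻¹ b).norm ≤ 1
      rw [← hm, img, MulAut.inv_apply_self]
      exact FreeGroup.norm_mk_le
  have h3 : ∀ x, (φ x).norm = x.norm := by
    intro x
    refine le_antisymm (norm_map_le φ.toMonoidHom h1 x) ?_
    have h4 := norm_map_le (φ⁻¹ : MulAut F2).toMonoidHom h2 (φ x)
    change (φ⁻¹ (φ x)).norm ≤ _ at h4
    rwa [MulAut.inv_apply_self] at h4
  rw [cycLen_eq_norm_sub, cycLen_eq_norm_sub, ← map_mul, h3, h3]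

/-! ### Automorphisms that act as chains -/

/-- On cyclic lengths `φ` acts as a positive chain, possibly preceded by `flipAut`. -/
def ActsAsChain (φ : MulAut F2) : Prop :=
  ∃ W, (∀ w, cycLen (φ w) = cycLen (act W w)) ∨ ∀ w, cycLen (φ w) = cycLen (act W (flipAut w))

/-- The automorphism `a ↦ a⁻¹`, `b ↦ b⁻¹`. -/
def negAut : MulAut F2 := flipAut * swapAut * flipAut * swapAut

@[simp] theorem negAut_a : negAut a = a⁻¹ := by simp [negAut]
@[simp] theorem negAut_b : negAut b = b⁻¹ := by simp [negAut]

theorem cycLen_negAut (w : F2) : cycLen (negAut w) = cycLen w := by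
  simp [negAut, cycLen_flipAut, cycLen_swapAut]

theorem conj_mul_conj_comm (φ : MulAut F2) (g : F2) :
    φ * MulAut.conj g = MulAut.conj (φ g) * φ := by
  ext x
  simp

theorem gen_mul_negAut (c : Bool) : ∃ g, gen c * negAut = MulAut.conj g * (negAut * gen c) := by
  cases c
  · exact ⟨a⁻¹, aut_ext (by simp [gen]) (by simp [gen]; group)⟩
  · exact ⟨b⁻¹, aut_ext (by simp [gen]; group) (by simp [gen])⟩

/-- Inverting both generators commutes with σ and τ up to inner automorphisms, which cyclic length
does not see. -/
theorem cycLen_act_negAut (W : List Bool) (w : F2) :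
    cycLen (act W (negAut w)) = cycLen (act W w) := by
  have : ∃ g, act W * negAut = MulAut.conj g * (negAut * act W) := by
    induction W with
    | nil => exact ⟨1, by simp⟩
    | cons c W ih =>
      obtain ⟨g, hg⟩ := ih
      obtain ⟨k, hk⟩ := gen_mul_negAut c
      refine ⟨gen c g * k, ?_⟩
      rw [act_cons, mul_assoc, hg, ← mul_assoc, conj_mul_conj_comm, map_mul, mul_assoc,
        ← mul_assoc (gen c), hk]
      simp only [mul_assoc]
  obtain ⟨g, hg⟩ := this
  rw [← MulAut.mul_apply, hg, MulAut.mul_apply, MulAut.conj_apply, cycLen_conj, MulAut.mul_apply,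
    cycLen_negAut]

theorem gen_mul_swapAut (c : Bool) : gen c * swapAut = swapAut * gen (!c) := by
  cases c <;> exact aut_ext (by simp [gen]) (by simp [gen])

theorem act_mul_swapAut (W : List Bool) : act W * swapAut = swapAut * act (W.map not) := by
  induction W with
  | nil => simp
  | cons c W ih =>
    rw [act_cons, mul_assoc, ih, ← mul_assoc, gen_mul_swapAut, List.map_cons, act_cons, mul_assoc]

theorem cycLen_act_swapAut (W : List Bool) (w : F2) :
    cycLen (act W (swapAut w)) = cycLen (act (W.map not) w) := by
  rw [← MulAut.mul_apply, act_mul_swapAut, MulAut.mul_apply, cycLen_swapAut]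

theorem ActsAsChain.mul_flipAut {φ : MulAut F2} (h : ActsAsChain φ) :
    ActsAsChain (φ * flipAut) := by
  obtain ⟨W, h | h⟩ := h
  · exact ⟨W, .inr fun w => h _⟩
  · refine ⟨W, .inl fun w => ?_⟩
    have e : flipAut (flipAut w) = w := DFunLike.congr_fun flipAut_mul_self w
    rw [MulAut.mul_apply, h, e]

theorem flipAut_swapAut (w : F2) : flipAut (swapAut w) = swapAut (negAut (flipAut w)) := by
  have : flipAut * swapAut = swapAut * (negAut * flipAut) := aut_ext (by simp) (by simp)
  exact DFunLike.congr_fun this w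

theorem ActsAsChain.mul_swapAut {φ : MulAut F2} (h : ActsAsChain φ) :
    ActsAsChain (φ * swapAut) := by
  obtain ⟨W, h | h⟩ := h
  · exact ⟨W.map not, .inl fun w => by rw [MulAut.mul_apply, h, cycLen_act_swapAut]⟩
  · exact ⟨W.map not, .inr fun w => by
      rw [MulAut.mul_apply, h, flipAut_swapAut, cycLen_act_swapAut, cycLen_act_negAut]⟩

/-- Only a flip in front of σ needs care, and the preceding letter of the chain absorbs it. After σ
the product σ·flip·σ is again the flip; after τ the product τ·flip·σ is τ followed by an exchange
and sign changes, so the flip disappears. -/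
theorem ActsAsChain.mul_sigma {φ : MulAut F2} (h : ActsAsChain φ) :
    ActsAsChain (φ * sigma) := by
  obtain ⟨W, h | h⟩ := h
  · refine ⟨W ++ [true], .inl fun w => ?_⟩
    rw [MulAut.mul_apply, h, act_append, act_cons, act_nil, mul_one]
    rfl
  · obtain rfl | ⟨W, c, rfl⟩ := W.eq_nil_or_concat'
    · refine ⟨[true], .inl fun w => ?_⟩
      rw [MulAut.mul_apply, h, act_nil, MulAut.one_apply, cycLen_flipAut, act_cons, act_nil,
        mul_one]
      rfl
    · have hg : act (W ++ [c]) = act W * gen c := by simp [act_append, act_cons]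
      rw [hg] at h
      cases c
      · refine ⟨W.map not ++ [false], .inl fun w => ?_⟩
        have e : tau * (flipAut * sigma) = negAut * (swapAut * tau) :=
          aut_ext (by simp) (by simp)
        have e' := DFunLike.congr_fun e w
        simp only [MulAut.mul_apply] at e'
        rw [MulAut.mul_apply, h, MulAut.mul_apply, act_append, act_cons, act_nil, mul_one,
          MulAut.mul_apply]
        change cycLen (act W (tau (flipAut (sigma w)))) = cycLen (act (W.map not) (tau w))
        rw [e', cycLen_act_negAut, cycLen_act_swapAut]
      · refine ⟨W, .inr fun w => ?_⟩
        have e : sigma * (flipAut * sigma) = flipAut := aut_ext (by simp) (by simp)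
        have e' := DFunLike.congr_fun e w
        simp only [MulAut.mul_apply] at e'
        rw [MulAut.mul_apply, h, MulAut.mul_apply]
        change cycLen (act W (sigma (flipAut (sigma w)))) = _
        rw [e']

theorem ActsAsChain.of_mul_flipAut {φ : MulAut F2} (h : ActsAsChain (φ * flipAut)) :
    ActsAsChain φ := by
  have := h.mul_flipAut
  rwa [mul_assoc, flipAut_mul_self, mul_one] at this

theorem ActsAsChain.of_mul_swapAut {φ : MulAut F2} (h : ActsAsChain (φ * swapAut)) :
    ActsAsChain φ := by
  have := h.mul_swapAut
  rwa [mul_assoc, swapAut_mul_self, mul_one] at this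

/-- The inverse of τ is the conjugate of σ by the product of the exchange and the flip, so closure
under σ gives closure under τ⁻¹. -/
theorem ActsAsChain.of_mul_tau {φ : MulAut F2} (h : ActsAsChain (φ * tau)) : ActsAsChain φ := by
  have h1 := h.mul_swapAut.mul_flipAut.mul_sigma.mul_flipAut.mul_swapAut
  have h2 : tau * swapAut * flipAut * sigma * flipAut * swapAut = 1 :=
    aut_ext (by simp) (by simp)
  simpa only [mul_assoc, mul_one] using (show φ * (tau * swapAut * flipAut * sigma * flipAut *
    swapAut) = φ by rw [h2, mul_one]) ▸ (by simpa only [mul_assoc] using h1 :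
      ActsAsChain (φ * (tau * swapAut * flipAut * sigma * flipAut * swapAut)))

theorem ActsAsChain.of_conj_mul {φ : MulAut F2} {g : F2} (h : ActsAsChain (MulAut.conj g * φ)) :
    ActsAsChain φ := by
  obtain ⟨W, h⟩ := h
  simp only [MulAut.mul_apply, MulAut.conj_apply, cycLen_conj] at h
  exact ⟨W, h⟩

/-- The total length of the images of the basis. -/
def basisNorm (φ : MulAut F2) : ℕ := (φ a).norm + (φ b).norm

/-! ### Nielsen reduction modulo inner automorphisms -/

/-- Any two letters with distinct bases are the images of `a` and `b` under an automorphism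
permuting the letters. -/
theorem exists_signed_perm {l m : Fin 2 × Bool} (h : l.1 ≠ m.1) :
    ∃ β : MulAut F2, β a = FreeGroup.mk [l] ∧ β b = FreeGroup.mk [m] ∧
      ∀ φ, ActsAsChain (φ * β) → ActsAsChain φ := by
  have key : ∀ c d, ∃ β : MulAut F2, β a = FreeGroup.mk [(0, c)] ∧ β b = FreeGroup.mk [(1, d)] ∧
      ∀ φ, ActsAsChain (φ * β) → ActsAsChain φ := by
    have e0 : FreeGroup.mk [((0 : Fin 2), false)] = a⁻¹ := rfl
    have e1 : FreeGroup.mk [((1 : Fin 2), false)] = b⁻¹ := rfl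
    have e2 : FreeGroup.mk [((0 : Fin 2), true)] = a := rfl
    have e3 : FreeGroup.mk [((1 : Fin 2), true)] = b := rfl
    intro c d
    cases c <;> cases d
    · refine ⟨flipAut * swapAut * flipAut * swapAut, by simp [e0], by simp [e1], fun φ h => ?_⟩
      simp only [← mul_assoc] at h
      exact h.of_mul_swapAut.of_mul_flipAut.of_mul_swapAut.of_mul_flipAut
    · refine ⟨swapAut * flipAut * swapAut, by simp [e0], by simp [e3], fun φ h => ?_⟩
      simp only [← mul_assoc] at h
      exact h.of_mul_swapAut.of_mul_flipAut.of_mul_swapAut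
    · exact ⟨flipAut, by simp [e2], by simp [e1], fun φ h => h.of_mul_flipAut⟩
    · exact ⟨1, by simp [e2], by simp [e3], fun φ h => by simpa using h⟩
  obtain ⟨i, c⟩ := l
  obtain ⟨j, d⟩ := m
  have hij : (i = 0 ∧ j = 1) ∨ (i = 1 ∧ j = 0) :=
    (by decide : ∀ i j : Fin 2, i ≠ j → (i = 0 ∧ j = 1) ∨ (i = 1 ∧ j = 0)) i j h
  rcases hij with ⟨rfl, rfl⟩ | ⟨rfl, rfl⟩
  · exact key c d
  · obtain ⟨β, h1, h2, h3⟩ := key d c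
    refine ⟨β * swapAut, by simp [h2], by simp [h1], fun φ h => h3 φ ?_⟩
    rw [← mul_assoc] at h
    exact h.of_mul_swapAut

theorem norm_img (φ : MulAut F2) (i : Fin 2) (c : Bool) :
    (img φ (i, c)).norm = (φ (FreeGroup.of i)).norm := by
  cases c
  · rw [show (i, false) = (i, !true) from rfl, img_inv, FreeGroup.norm_inv_eq]
    rfl
  · rfl

theorem norm_img_add (φ : MulAut F2) {l m : Fin 2 × Bool} (h : l.1 ≠ m.1) :
    (img φ l).norm + (img φ m).norm = basisNorm φ := by
  obtain ⟨i, c⟩ := l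
  obtain ⟨j, d⟩ := m
  rw [norm_img, norm_img]
  have hij : (i = 0 ∧ j = 1) ∨ (i = 1 ∧ j = 0) :=
    (by decide : ∀ i j : Fin 2, i ≠ j → (i = 0 ∧ j = 1) ∨ (i = 1 ∧ j = 0)) i j h
  rcases hij with ⟨rfl, rfl⟩ | ⟨rfl, rfl⟩
  · rfl
  · rw [add_comm]; rfl

theorem norm_lt_norm_mul_self {x : F2} (hx : x ≠ 1) : x.norm < (x * x).norm := by
  have h1 := cycLen_eq_norm_sub x
  have h2 := cycLen_pos hx
  omega

/-- If half of `x` cancels in both `y x` and `x y`, then a conjugate of the pair `x, y x` is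
shorter than `x, y`. -/
theorem exists_conj_shorter {x y : F2} (hx : x ≠ 1) (hyx : (y * x).norm = y.norm)
    (hxy : (x * y).norm = y.norm) (hle : x.norm ≤ y.norm) :
    ∃ g, (g * x * g⁻¹).norm + (g * (y * x) * g⁻¹).norm < x.norm + y.norm := by
  have h1 := norm_mul_add y x
  have h2 := norm_mul_add x y
  rw [hyx] at h1
  rw [hxy] at h2
  set m := lcp y⁻¹.toWord x.toWord with hm
  have hm' : lcp x⁻¹.toWord y.toWord = m := by omega
  have t1 := take_lcp y⁻¹.toWord x.toWord
  have t2 := take_lcp x⁻¹.toWord y.toWord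
  rw [← hm] at t1
  rw [hm'] at t2
  have hx0 : x.norm ≠ 0 := by rwa [ne_eq, FreeGroup.norm_eq_zero]
  set p := x.toWord.take m with hp
  set q := y.toWord.take m with hq
  have hxl : x.toWord.length = 2 * m := by
    change x.norm = _
    omega
  have hyl : y.toWord.length = y.norm := rfl
  have hpl : p.length = m := by
    rw [hp, List.length_take]
    omega
  have hql : q.length = m := by
    rw [hq, List.length_take]
    omega
  have hx_eq : x = FreeGroup.mk p * (FreeGroup.mk q)⁻¹ := by
    have h3 : x.toWord.drop m = FreeGroup.invRev q := by
      rw [← t2, FreeGroup.toWord_inv]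
      simp only [FreeGroup.invRev, List.take_reverse, List.length_map, hxl,
        show 2 * m - m = m by omega, ← List.map_drop, List.map_reverse, List.reverse_reverse,
        List.map_map]
      refine (List.map_id _).symm.trans (List.map_congr_left fun z _ => ?_)
      simp
    rw [FreeGroup.inv_mk, FreeGroup.mul_mk, ← h3, hp, List.take_append_drop, FreeGroup.mk_toWord]
  have hy_eq : ∃ z : List (Fin 2 × Bool), z.length + 2 * m = y.norm ∧
      y = FreeGroup.mk q * FreeGroup.mk z * (FreeGroup.mk p)⁻¹ := by
    have h3 : y.toWord.drop (y.norm - m) = FreeGroup.invRev p := by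
      rw [← t1, FreeGroup.toWord_inv]
      simp only [FreeGroup.invRev, List.take_reverse, List.length_map, hyl,
        ← List.map_drop, List.map_reverse, List.reverse_reverse, List.map_map]
      refine (List.map_id _).symm.trans (List.map_congr_left fun z _ => ?_)
      simp
    refine ⟨(y.toWord.drop m).take (y.norm - 2 * m), ?_, ?_⟩
    · rw [List.length_take, List.length_drop]
      omega
    · have h4 : (y.toWord.drop m).drop (y.norm - 2 * m) = FreeGroup.invRev p := by
        rw [List.drop_drop, ← h3]
        congr 1
        omega
      rw [FreeGroup.inv_mk, FreeGroup.mul_mk, FreeGroup.mul_mk, ← h4, List.append_assoc,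
        List.take_append_drop, hq, List.take_append_drop, FreeGroup.mk_toWord]
  obtain ⟨z, hz, hy_eq⟩ := hy_eq
  refine ⟨(FreeGroup.mk q)⁻¹, ?_⟩
  have e1 : (FreeGroup.mk q)⁻¹ * x * (FreeGroup.mk q)⁻¹⁻¹ =
      (FreeGroup.mk q)⁻¹ * FreeGroup.mk p := by
    rw [hx_eq]
    group
  have e2 : (FreeGroup.mk q)⁻¹ * (y * x) * (FreeGroup.mk q)⁻¹⁻¹ = FreeGroup.mk z := by
    rw [hy_eq, hx_eq]
    group
  rw [e1, e2]
  have h5 := FreeGroup.norm_mul_le (FreeGroup.mk q)⁻¹ (FreeGroup.mk p)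
  have h6 : (FreeGroup.mk q).norm ≤ q.length := FreeGroup.norm_mk_le
  have h7 : (FreeGroup.mk p).norm ≤ p.length := FreeGroup.norm_mk_le
  have h8 : (FreeGroup.mk z).norm ≤ z.length := FreeGroup.norm_mk_le
  rw [FreeGroup.norm_inv_eq] at h5
  omega

/-- The two halves of a nontrivial element are not inverse to each other. -/
theorem norm_mul_ne_of_inv {x y : F2} (hx : x ≠ 1) (hyx : (y * x).norm = y.norm) :
    (x * y⁻¹).norm ≠ y.norm := by
  intro hxy
  have h1 := norm_mul_add y x
  have h2 := norm_mul_add x y⁻¹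
  rw [FreeGroup.norm_inv_eq] at h2
  rw [hyx] at h1
  rw [hxy] at h2
  have hm : lcp x⁻¹.toWord y⁻¹.toWord = lcp y⁻¹.toWord x.toWord := by omega
  have h3 := min_lcp_le x.toWord y⁻¹.toWord x⁻¹.toWord
  rw [lcp_comm y⁻¹.toWord, hm, lcp_comm x.toWord, min_self] at h3
  have h4 := norm_inv_mul x x⁻¹
  have h5 := norm_lt_norm_mul_self (x := x⁻¹) (by simpa using hx)
  rw [FreeGroup.norm_inv_eq] at h4 h5
  have h6 : x.norm ≠ 0 := by rwa [ne_eq, FreeGroup.norm_eq_zero]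
  omega

/-- Nielsen's reduction process. -/
theorem actsAsChain (φ : MulAut F2) : ActsAsChain φ := by
  induction hn : basisNorm φ using Nat.strong_induction_on generalizing φ with
  | _ n ih =>
    subst hn
    have hβ : ∀ (β : MulAut F2) {l m}, l.1 ≠ m.1 → β a = FreeGroup.mk [l] →
        β b = FreeGroup.mk [m] → (φ * β) a = img φ l ∧ (φ * β) b = img φ m ∧
          (img φ l).norm + (img φ m).norm = basisNorm φ := by
      intro β l m hlm hl hm
      refine ⟨?_, ?_, norm_img_add φ hlm⟩
      · rw [MulAut.mul_apply, hl, img]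
      · rw [MulAut.mul_apply, hm, img]
    by_cases h : NielsenReduced φ
    · exact ⟨[], .inl fun w => h.cycLen_eq w⟩
    by_cases h1 : ∀ l m, NoCancel l m → (img φ l).norm ≤ (img φ l * img φ m).norm
    -- No product is shorter than a factor, yet the middle letter m is entirely cancelled by its
    -- neighbours. Equality is then forced: half of the image of m cancels on each side, and l and k
    -- have the same base.
    · have h2 : ∃ l m k, NoCancel l m ∧ NoCancel m k ∧ (img φ l * img φ m).norm +
          (img φ m * img φ k).norm ≤ (img φ l).norm + (img φ k).norm := by
        by_contra! h2
        exact h ⟨h1, h2⟩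
      obtain ⟨l, m, k, hlm, hmk, hle⟩ := h2
      have hright : ∀ l m, NoCancel l m → (img φ m).norm ≤ (img φ l * img φ m).norm := by
        rintro ⟨i, c⟩ ⟨j, d⟩ hlm
        have := h1 (j, !d) (i, !c) (fun hij => by simpa using (hlm hij.symm).symm)
        rwa [img_inv, img_inv, ← mul_inv_rev, FreeGroup.norm_inv_eq, FreeGroup.norm_inv_eq] at this
      have e1 := h1 l m hlm
      have e2 := hright m k hmk
      have e3 := hright l m hlm
      have e4 := h1 m k hmk
      have hlm' : l.1 ≠ m.1 := by
        intro hE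
        obtain rfl : l = m := Prod.ext hE (hlm hE)
        have := norm_lt_norm_mul_self (img_ne_one φ l)
        omega
      have hmk' : m.1 ≠ k.1 := by
        intro hE
        obtain rfl : m = k := Prod.ext hE (hmk hE)
        have := norm_lt_norm_mul_self (img_ne_one φ m)
        omega
      have hlk : l.1 = k.1 :=
        (by decide : ∀ x y z : Fin 2, x ≠ y → y ≠ z → x = z) _ _ _ hlm' hmk'
      by_cases hlk' : l.2 = k.2
      · obtain rfl : l = k := Prod.ext hlk hlk'
        obtain ⟨β, b1, b2, b3⟩ := exists_signed_perm hlm'.symm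
        obtain ⟨b4, b5, b6⟩ := hβ β hlm'.symm b1 b2
        -- Multiplication alone keeps the total length here; a conjugation, invisible to cyclic
        -- length, makes it drop.
        obtain ⟨g, hg⟩ := exists_conj_shorter (img_ne_one φ m) (y := img φ l) (by omega) (by omega)
          (by omega)
        refine b3 φ (ActsAsChain.of_mul_tau (ActsAsChain.of_conj_mul (g := g) (ih _ ?_ _ rfl)))
        have t1 : (φ * β * tau) a = img φ m := by rw [MulAut.mul_apply, tau_a, b4]
        have t2 : (φ * β * tau) b = img φ l * img φ m := by
          rw [MulAut.mul_apply, tau_b, map_mul, b4, b5]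
        change (MulAut.conj g ((φ * β * tau) a)).norm + (MulAut.conj g ((φ * β * tau) b)).norm < _
        rw [t1, t2, MulAut.conj_apply, MulAut.conj_apply]
        omega
      · have hk : k = (l.1, !l.2) := by
          refine Prod.ext hlk.symm ?_
          change k.2 = !l.2
          revert hlk'
          cases k.2 <;> cases l.2 <;> decide
        have hk' : img φ k = (img φ l)⁻¹ := by rw [hk, img_inv]
        rw [hk', FreeGroup.norm_inv_eq] at hle e2
        exact absurd (by omega) (norm_mul_ne_of_inv (img_ne_one φ m) (y := img φ l) (by omega))
    · push Not at h1
      obtain ⟨l, m, hlm, hlt⟩ := h1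
      have hlm' : l.1 ≠ m.1 := by
        intro hE
        obtain rfl : l = m := Prod.ext hE (hlm hE)
        have := norm_lt_norm_mul_self (img_ne_one φ l)
        omega
      obtain ⟨β, b1, b2, b3⟩ := exists_signed_perm hlm'.symm
      obtain ⟨b4, b5, b6⟩ := hβ β hlm'.symm b1 b2
      refine b3 φ (ActsAsChain.of_mul_tau (ih _ ?_ _ rfl))
      have t1 : (φ * β * tau) a = img φ m := by rw [MulAut.mul_apply, tau_a, b4]
      have t2 : (φ * β * tau) b = img φ l * img φ m := by
        rw [MulAut.mul_apply, tau_b, map_mul, b4, b5]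
      rw [basisNorm, t1, t2]
      omega

/-! ### Bounded translation equivalence in terms of stability -/

theorem boundedlyTranslationEquivalent_iff_nat {u v : F2} :
    BoundedlyTranslationEquivalent u v ↔
      (∃ C : ℕ, ∀ φ : MulAut F2, cycLen (φ u) ≤ C * cycLen (φ v)) ∧
        ∃ C : ℕ, ∀ φ : MulAut F2, cycLen (φ v) ≤ C * cycLen (φ u) := by
  constructor
  · rintro ⟨C, hC, h⟩
    have hn : ∀ x : ℕ, C * (x : ℝ) ≤ (⌈C⌉₊ * x : ℕ) := by
      intro x
      push_cast
      gcongr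
      exact Nat.le_ceil C
    refine ⟨⟨⌈C⌉₊, fun φ => ?_⟩, ⌈C⌉₊, fun φ => ?_⟩
    · exact_mod_cast (h φ).2.trans (hn _)
    · have h1 := (h φ).1
      rw [one_div, inv_mul_le_iff₀ hC] at h1
      exact_mod_cast h1.trans (hn _)
  · rintro ⟨⟨C, hC⟩, D, hD⟩
    have hpos : (0 : ℝ) < C + D + 1 := by positivity
    refine ⟨C + D + 1, hpos, fun φ => ⟨?_, ?_⟩⟩
    · rw [one_div, inv_mul_le_iff₀ hpos]
      calc (cycLen (φ v) : ℝ) ≤ D * cycLen (φ u) := by exact_mod_cast hD φ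
        _ ≤ (C + D + 1) * cycLen (φ u) := by
          gcongr
          have : (0 : ℝ) ≤ C := by positivity
          linarith
    · calc (cycLen (φ u) : ℝ) ≤ C * cycLen (φ v) := by exact_mod_cast hC φ
        _ ≤ (C + D + 1) * cycLen (φ v) := by
          gcongr
          have : (0 : ℝ) ≤ D := by positivity
          linarith

/-- By `actsAsChain`, the positive chains with and without an initial flip account for all
automorphisms. -/
theorem chainDominated_and_flip_iff {u v : F2} :
    (∃ C : ℕ, ∀ φ : MulAut F2, cycLen (φ u) ≤ C * cycLen (φ v)) ↔
      ChainDominated u v ∧ ChainDominated (flipAut u) (flipAut v) := by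
  constructor
  · rintro ⟨C, hC⟩
    exact ⟨⟨C, fun W => hC (act W)⟩, C, fun W => hC (act W * flipAut)⟩
  · rintro ⟨⟨C, hC⟩, D, hD⟩
    refine ⟨C + D, fun φ => ?_⟩
    rw [add_mul]
    obtain ⟨W, h | h⟩ := actsAsChain φ
    · rw [h, h]
      exact (hC W).trans (Nat.le_add_right _ _)
    · rw [h, h]
      exact (hD W).trans (Nat.le_add_left _ _)

/-- On all positive chains of length `N` the words `u` and `v` are stable for the same
generators. -/
def StableAlike (N k : ℕ) (u v : F2) : Prop :=
  ∀ W : List Bool, W.length = N → ∀ c, (Stable k c (act W u) ↔ Stable k c (act W v))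

theorem BoundedlyTranslationEquivalent.stable_iff {u v : F2}
    (h : BoundedlyTranslationEquivalent u v) (hu : u ≠ 1) (hv : v ≠ 1) {k : ℕ}
    (hku : cycLen u ≤ k) (hkv : cycLen v ≤ k) (W : List Bool) (c : Bool) :
    (Stable k c (act W u) ↔ Stable k c (act W v)) ∧
      (Stable k c (act W (flipAut u)) ↔ Stable k c (act W (flipAut v))) := by
  rw [boundedlyTranslationEquivalent_iff_nat, chainDominated_and_flip_iff,
    chainDominated_and_flip_iff] at h
  obtain ⟨⟨h1, h2⟩, h3, h4⟩ := h
  have hu' : flipAut u ≠ 1 := by simpa using hu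
  have hv' : flipAut v ≠ 1 := by simpa using hv
  have hku' : cycLen (flipAut u) ≤ k := by rwa [cycLen_flipAut]
  have hkv' : cycLen (flipAut v) ≤ k := by rwa [cycLen_flipAut]
  exact ⟨⟨h3.stable hv hu hkv hku W c, h1.stable hu hv hku hkv W c⟩,
    h4.stable hv' hu' hkv' hku' W c, h2.stable hu' hv' hku' hkv' W c⟩

theorem boundedlyTranslationEquivalent_of_stableAlike {u v : F2} (hu : u ≠ 1) (hv : v ≠ 1)
    {N k : ℕ} (hNu : cycLen u < N) (hNv : cycLen v < N) (hk : k ≠ 0)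
    (h : StableAlike N k u v) (h' : StableAlike N k (flipAut u) (flipAut v)) :
    BoundedlyTranslationEquivalent u v := by
  rw [boundedlyTranslationEquivalent_iff_nat, chainDominated_and_flip_iff,
    chainDominated_and_flip_iff]
  have hu' : flipAut u ≠ 1 := by simpa using hu
  have hv' : flipAut v ≠ 1 := by simpa using hv
  have hNu' : cycLen (flipAut u) < N := by rwa [cycLen_flipAut]
  have hNv' : cycLen (flipAut v) < N := by rwa [cycLen_flipAut]
  exact ⟨⟨chainDominated_of_stable hu hv hNu hNv hk fun W hW c => (h W hW c).2,
    chainDominated_of_stable hu' hv' hNu' hNv' hk fun W hW c => (h' W hW c).2⟩,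
    chainDominated_of_stable hv hu hNv hNu hk fun W hW c => (h W hW c).1,
    chainDominated_of_stable hv' hu' hNv' hNu' hk fun W hW c => (h' W hW c).1⟩

theorem boundedlyTranslationEquivalent_one_iff {u v : F2}
    (h : BoundedlyTranslationEquivalent u v) : u = 1 ↔ v = 1 := by
  obtain ⟨⟨C, hC⟩, D, hD⟩ := boundedlyTranslationEquivalent_iff_nat.1 h
  have h1 := hC 1
  have h2 := hD 1
  rw [MulAut.one_apply, MulAut.one_apply] at h1 h2
  constructor
  · rintro rfl
    rw [cycLen_one, mul_zero] at h2
    exact cycLen_eq_zero.1 (Nat.le_zero.1 h2)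
  · rintro rfl
    rw [cycLen_one, mul_zero] at h1
    exact cycLen_eq_zero.1 (Nat.le_zero.1 h1)

/-! ### Chains of types (C1) and (C2), and the criterion -/

/-- The product of the automorphisms `s` (for `true`) and `t` (for `false`) along a list. -/
def wordProd (s t : MulAut F2) (W : List Bool) : MulAut F2 :=
  (W.map fun c => if c then s else t).prod

theorem wordProd_append (s t : MulAut F2) (V W : List Bool) :
    wordProd s t (V ++ W) = wordProd s t V * wordProd s t W := by
  simp [wordProd]

theorem wordProd_replicate (s t : MulAut F2) (n : ℕ) (c : Bool) :
    wordProd s t (List.replicate n c) = (if c then s else t) ^ n := by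
  simp [wordProd, List.prod_replicate]

theorem exists_wordProd_eq_chain (s t : MulAut F2) (L : List (ℕ × ℕ)) :
    ∃ W : List Bool, W.length = chainLength L ∧ chain s t L = wordProd s t W := by
  induction L with
  | nil => exact ⟨[], rfl, rfl⟩
  | cons p L ih =>
    obtain ⟨W, h1, h2⟩ := ih
    refine ⟨List.replicate p.2 false ++ List.replicate p.1 true ++ W, ?_, ?_⟩
    · simp only [chainLength] at h1
      simp only [chainLength, List.length_append, List.length_replicate, List.map_cons,
        List.sum_cons, h1]
    · simp only [chain] at h2
      simp [chain, wordProd_append, wordProd_replicate, h2, mul_assoc]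

theorem exists_chain_eq_wordProd (s t : MulAut F2) (W : List Bool) :
    ∃ L : List (ℕ × ℕ), chainLength L = W.length ∧ wordProd s t W = chain s t L := by
  refine ⟨W.map fun c => if c then (1, 0) else (0, 1), ?_, ?_⟩
  · induction W with
    | nil => rfl
    | cons c W ih =>
      simp only [chainLength] at ih
      simp only [chainLength, List.map_cons, List.sum_cons, List.length_cons]
      rw [ih]
      cases c <;> simp [add_comm]
  · induction W with
    | nil => rfl
    | cons c W ih =>
      simp only [chain, wordProd] at ih
      cases c <;> simp [chain, wordProd, ih]

theorem chains_eq_image (s t : MulAut F2) (n : ℕ) :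
    {ψ | ∃ L : List (ℕ × ℕ), chainLength L ≤ n ∧ ψ = chain s t L} =
      wordProd s t '' {W | W.length ≤ n} := by
  ext ψ
  constructor
  · rintro ⟨L, hL, rfl⟩
    obtain ⟨W, h1, h2⟩ := exists_wordProd_eq_chain s t L
    exact ⟨W, h1.trans_le hL, h2.symm⟩
  · rintro ⟨W, hW, rfl⟩
    obtain ⟨L, h1, h2⟩ := exists_chain_eq_wordProd s t W
    exact ⟨L, h1.trans_le hW, h2⟩

theorem chainsC1_eq (n : ℕ) : chainsC1 n = wordProd sigma tau '' {W | W.length ≤ n} :=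
  chains_eq_image _ _ _

theorem chainsC2_eq (n : ℕ) : chainsC2 n = wordProd sigma⁻¹ tau⁻¹ '' {W | W.length ≤ n} :=
  chains_eq_image _ _ _

theorem chainsC1_finite (n : ℕ) : (chainsC1 n).Finite := by
  rw [chainsC1_eq]
  exact (List.finite_length_le Bool n).image _

theorem chainsC2_finite (n : ℕ) : (chainsC2 n).Finite := by
  rw [chainsC2_eq]
  exact (List.finite_length_le Bool n).image _

theorem sigma_inv_a : sigma⁻¹ a = a * b⁻¹ := by
  rw [MulAut.inv_apply, MulEquiv.symm_apply_eq]
  simp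

theorem sigma_inv_b : sigma⁻¹ b = b := by
  rw [MulAut.inv_apply, MulEquiv.symm_apply_eq]
  simp

theorem tau_inv_a : tau⁻¹ a = a := by
  rw [MulAut.inv_apply, MulEquiv.symm_apply_eq]
  simp

theorem tau_inv_b : tau⁻¹ b = b * a⁻¹ := by
  rw [MulAut.inv_apply, MulEquiv.symm_apply_eq]
  simp

/-- `flipAut` conjugates chains of type (C2) to chains of type (C1), up to inner automorphisms. -/
theorem cycLen_wordProd_inv (W : List Bool) (w : F2) :
    cycLen (wordProd sigma⁻¹ tau⁻¹ W w) = cycLen (act W (flipAut w)) := by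
  have hgen : ∀ c : Bool, ∃ g, flipAut * (if c then sigma⁻¹ else tau⁻¹) =
      MulAut.conj g * gen c * flipAut := by
    intro c
    cases c
    · exact ⟨a, aut_ext (by simp [gen, tau_inv_a, -MulAut.inv_apply])
        (by simp [gen, tau_inv_b, -MulAut.inv_apply])⟩
    · exact ⟨1, aut_ext (by simp [gen, sigma_inv_a, -MulAut.inv_apply])
        (by simp [gen, sigma_inv_b, -MulAut.inv_apply])⟩
  have key : ∃ g, flipAut * wordProd sigma⁻¹ tau⁻¹ W = MulAut.conj g * act W * flipAut := by
    induction W with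
    | nil => exact ⟨1, by simp [wordProd]⟩
    | cons c W ih =>
      obtain ⟨g, hg⟩ := ih
      obtain ⟨k, hk⟩ := hgen c
      refine ⟨k * gen c g, ?_⟩
      have e : wordProd sigma⁻¹ tau⁻¹ (c :: W) =
          (if c then sigma⁻¹ else tau⁻¹) * wordProd sigma⁻¹ tau⁻¹ W := by simp [wordProd]
      rw [e, ← mul_assoc, hk, mul_assoc, hg, map_mul, act_cons, ← mul_assoc, ← mul_assoc,
        mul_assoc (MulAut.conj k), conj_mul_conj_comm]
      simp only [mul_assoc]
  obtain ⟨g, hg⟩ := key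
  have := DFunLike.congr_fun hg w
  simp only [MulAut.mul_apply, MulAut.conj_apply] at this
  rw [← cycLen_flipAut (wordProd _ _ W w), this, cycLen_conj]

theorem sameStability_C1_iff {n k : ℕ} {u v : F2} :
    SameStability sigma tau (chainsC1 n) k u v ↔
      ∀ W : List Bool, W.length ≤ n → ∀ c, (Stable k c (act W u) ↔ Stable k c (act W v)) := by
  rw [SameStability, chainsC1_eq, Set.forall_mem_image]
  refine forall₂_congr fun W _ => ?_
  rw [Bool.forall_bool, and_comm]
  rfl

theorem sameStability_C2_iff {n k : ℕ} {u v : F2} :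
    SameStability sigma⁻¹ tau⁻¹ (chainsC2 n) k u v ↔
      ∀ W : List Bool, W.length ≤ n → ∀ c,
        (Stable k c (act W (flipAut u)) ↔ Stable k c (act W (flipAut v))) := by
  have key : ∀ (j : ℕ) (c : Bool) (W : List Bool) (x : F2),
      cycLen (((if c then sigma⁻¹ else tau⁻¹) ^ j) (wordProd sigma⁻¹ tau⁻¹ W x)) =
        cycLen ((gen c ^ j) (act W (flipAut x))) := by
    intro j c W x
    -- The power is absorbed into the chain, so that the passage from inverse to positive chains is
    -- made for a single word.
    rw [← wordProd_replicate, ← MulAut.mul_apply, ← wordProd_append, cycLen_wordProd_inv,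
      act_append, act_replicate, MulAut.mul_apply]
  rw [SameStability, chainsC2_eq, Set.forall_mem_image]
  refine forall₂_congr fun W _ => ?_
  rw [Bool.forall_bool, and_comm]
  simp only [Stable, ← key]
  rfl

theorem chainCriterion_of_boundedlyTranslationEquivalent {u v : F2} (huv : cycLen v ≤ cycLen u)
    (h : BoundedlyTranslationEquivalent u v) : ChainCriterion u v := by
  by_cases hu : u = 1
  · have hv := (boundedlyTranslationEquivalent_one_iff h).1 hu
    subst hu hv
    exact ⟨fun _ _ => ⟨Iff.rfl, Iff.rfl⟩, fun _ _ => ⟨Iff.rfl, Iff.rfl⟩⟩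
  · have hv : v ≠ 1 := fun hv => hu ((boundedlyTranslationEquivalent_one_iff h).2 hv)
    have key := h.stable_iff hu hv (k := cycLen u + 1) (by omega) (by omega)
    exact ⟨sameStability_C1_iff.2 fun W _ c => (key W c).1,
      sameStability_C2_iff.2 fun W _ c => (key W c).2⟩

/-- Only the chains of length exactly ‖u‖ + 1 are needed; the criterion provides all lengths up to
2‖u‖ + 5. -/
theorem boundedlyTranslationEquivalent_of_chainCriterion {u v : F2} (hu : u ≠ 1) (hv : v ≠ 1)
    (huv : cycLen v ≤ cycLen u) (h : ChainCriterion u v) : BoundedlyTranslationEquivalent u v := by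
  obtain ⟨h1, h2⟩ := h
  rw [sameStability_C1_iff] at h1
  rw [sameStability_C2_iff] at h2
  exact boundedlyTranslationEquivalent_of_stableAlike hu hv (N := cycLen u + 1) (by omega)
    (by omega) (Nat.succ_ne_zero _) (fun W hW => h1 W (by omega)) fun W hW => h2 W (by omega)

/-! ### The decision procedure on words -/

/-- The word substituted for a letter by `gen c`. -/
def genLetter (c : Bool) (l : Fin 2 × Bool) : List (Fin 2 × Bool) :=
  if l = (if c then 0 else 1, true) then [(if c then 0 else 1, true), (if c then 1 else 0, true)]
  else if l = (if c then 0 else 1, false) then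
    [(if c then 1 else 0, false), (if c then 0 else 1, false)]
  else [l]

/-- The effect of `gen c` on (not necessarily reduced) words. -/
def genWord (c : Bool) (L : List (Fin 2 × Bool)) : List (Fin 2 × Bool) := L.flatMap (genLetter c)

/-- The effect of `flipAut` on words. -/
def flipWord (L : List (Fin 2 × Bool)) : List (Fin 2 × Bool) :=
  L.map fun l => if l.1 = 1 then (l.1, !l.2) else l

/-- The length of the reduced form of a word. -/
def normWord (L : List (Fin 2 × Bool)) : ℕ := (FreeGroup.reduce L).length

/-- The cyclic length of the element represented by a word. -/
def cycLenWord (L : List (Fin 2 × Bool)) : ℕ := normWord (L ++ L) - normWord L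

theorem mk_flatMap_eq_map (φ : MulAut F2) (f : Fin 2 × Bool → List (Fin 2 × Bool))
    (h : ∀ l, FreeGroup.mk (f l) = φ (FreeGroup.mk [l])) (L : List (Fin 2 × Bool)) :
    FreeGroup.mk (L.flatMap f) = φ (FreeGroup.mk L) := by
  induction L with
  | nil => exact (map_one φ).symm
  | cons l L ih =>
    rw [List.flatMap_cons, ← FreeGroup.mul_mk, ih, h, ← map_mul, FreeGroup.mul_mk,
      List.singleton_append]

theorem mk_genWord (c : Bool) (L : List (Fin 2 × Bool)) :
    FreeGroup.mk (genWord c L) = gen c (FreeGroup.mk L) := by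
  refine mk_flatMap_eq_map _ _ (fun l => ?_) L
  have ha : sigma a⁻¹ = b⁻¹ * a⁻¹ := by simp
  have hb : sigma b⁻¹ = b⁻¹ := by simp
  have ha' : tau a⁻¹ = a⁻¹ := by simp
  have hb' : tau b⁻¹ = a⁻¹ * b⁻¹ := by simp
  obtain ⟨i, d⟩ := l
  rcases eq_zero_or_one i with rfl | rfl <;> cases c <;> cases d
  · exact ha'.symm
  · exact tau_a.symm
  · exact ha.symm
  · exact sigma_a.symm
  · exact hb'.symm
  · exact tau_b.symm
  · exact hb.symm
  · exact sigma_b.symm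

theorem mk_flipWord (L : List (Fin 2 × Bool)) :
    FreeGroup.mk (flipWord L) = flipAut (FreeGroup.mk L) := by
  rw [flipWord, List.map_eq_flatMap]
  refine mk_flatMap_eq_map _ _ (fun l => ?_) L
  have ha : flipAut a⁻¹ = a⁻¹ := by simp
  have hb : flipAut b⁻¹ = b := by simp
  obtain ⟨i, d⟩ := l
  rcases eq_zero_or_one i with rfl | rfl <;> cases d
  · exact ha.symm
  · exact flipAut_a.symm
  · exact hb.symm
  · exact flipAut_b.symm

theorem mk_iterate_genWord (c : Bool) (k : ℕ) (L : List (Fin 2 × Bool)) :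
    FreeGroup.mk ((genWord c)^[k] L) = (gen c ^ k) (FreeGroup.mk L) := by
  induction k with
  | zero => simp
  | succ k ih => rw [Function.iterate_succ_apply', mk_genWord, ih, pow_succ', MulAut.mul_apply]

theorem normWord_eq (L : List (Fin 2 × Bool)) : normWord L = (FreeGroup.mk L).norm := rfl

theorem cycLenWord_eq (L : List (Fin 2 × Bool)) : cycLenWord L = cycLen (FreeGroup.mk L) := by
  rw [cycLenWord, normWord_eq, normWord_eq, ← FreeGroup.mul_mk, cycLen_eq_norm_sub]

/-- Pairs of words. -/
abbrev WordPair : Type := List (Fin 2 × Bool) × List (Fin 2 × Bool)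

/-- The images of a pair under `gen true` and `gen false`. -/
def successors (p : WordPair) : List WordPair :=
  [(genWord true p.1, genWord true p.2), (genWord false p.1, genWord false p.2)]

/-- The images of a pair under all positive chains of length `N`. -/
def level (N : ℕ) (p : WordPair) : List WordPair := (fun Q => Q.flatMap successors)^[N] [p]

theorem mem_level {N : ℕ} {p q : WordPair} (hq : q ∈ level N p) :
    ∃ W : List Bool, W.length = N ∧ FreeGroup.mk q.1 = act W (FreeGroup.mk p.1) ∧
      FreeGroup.mk q.2 = act W (FreeGroup.mk p.2) := by
  induction N generalizing q with
  | zero =>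
    obtain rfl : q = p := by simpa [level] using hq
    exact ⟨[], rfl, rfl, rfl⟩
  | succ N ih =>
    rw [level, Function.iterate_succ_apply', List.mem_flatMap] at hq
    obtain ⟨r, hr, hq⟩ := hq
    obtain ⟨W, h1, h2, h3⟩ := ih hr
    have : ∃ c, q = (genWord c r.1, genWord c r.2) := by
      rw [successors, List.mem_pair] at hq
      rcases hq with rfl | rfl
      · exact ⟨true, rfl⟩
      · exact ⟨false, rfl⟩
    obtain ⟨c, rfl⟩ := this
    refine ⟨c :: W, by simp [h1], ?_, ?_⟩
    · rw [mk_genWord, h2, act_cons, MulAut.mul_apply]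
    · rw [mk_genWord, h3, act_cons, MulAut.mul_apply]

theorem exists_mem_level (p : WordPair) (W : List Bool) :
    ∃ q ∈ level W.length p, FreeGroup.mk q.1 = act W (FreeGroup.mk p.1) ∧
      FreeGroup.mk q.2 = act W (FreeGroup.mk p.2) := by
  induction W with
  | nil => exact ⟨p, by simp [level], rfl, rfl⟩
  | cons c W ih =>
    obtain ⟨q, h1, h2, h3⟩ := ih
    refine ⟨(genWord c q.1, genWord c q.2), ?_, ?_, ?_⟩
    · rw [List.length_cons, level, Function.iterate_succ_apply', List.mem_flatMap]
      refine ⟨q, h1, ?_⟩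
      cases c <;> simp [successors]
    · rw [mk_genWord, h2, act_cons, MulAut.mul_apply]
    · rw [mk_genWord, h3, act_cons, MulAut.mul_apply]

/-- The word version of `Stable`. -/
def StableWord (k : ℕ) (c : Bool) (L : List (Fin 2 × Bool)) : Prop :=
  cycLenWord ((genWord c)^[k + 1] L) = cycLenWord ((genWord c)^[k] L)

theorem stableWord_iff {k : ℕ} {c : Bool} {L : List (Fin 2 × Bool)} :
    StableWord k c L ↔ Stable k c (FreeGroup.mk L) := by
  rw [StableWord, cycLenWord_eq, cycLenWord_eq, mk_iterate_genWord, mk_iterate_genWord, Stable]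

/-- The two words of a pair are stable for the same generators. -/
def StableAlikeWord (q : WordPair) (k : ℕ) : Prop :=
  (StableWord k true q.1 ↔ StableWord k true q.2) ∧
    (StableWord k false q.1 ↔ StableWord k false q.2)

theorem stableAlike_iff_level {N k : ℕ} {p : WordPair} :
    StableAlike N k (FreeGroup.mk p.1) (FreeGroup.mk p.2) ↔
      ∀ q ∈ level N p, StableAlikeWord q k := by
  constructor
  · intro h q hq
    obtain ⟨W, h1, h2, h3⟩ := mem_level hq
    have h4 := h W h1
    rw [← h2, ← h3] at h4
    simp only [StableAlikeWord, stableWord_iff]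
    exact ⟨h4 true, h4 false⟩
  · rintro h W rfl c
    obtain ⟨q, h1, h2, h3⟩ := exists_mem_level p W
    have h4 := h q h1
    simp only [StableAlikeWord, stableWord_iff] at h4
    rw [← h2, ← h3]
    cases c
    · exact h4.2
    · exact h4.1

/-- The decision procedure for bounded translation equivalence. -/
theorem boundedlyTranslationEquivalent_mk_iff (p : WordPair) :
    BoundedlyTranslationEquivalent (FreeGroup.mk p.1) (FreeGroup.mk p.2) ↔
      (normWord p.1 = 0 ∧ normWord p.2 = 0) ∨
        ((¬ normWord p.1 = 0 ∧ ¬ normWord p.2 = 0) ∧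
          (∀ q ∈ level (p.1.length + p.2.length + 1) p,
            StableAlikeWord q (p.1.length + p.2.length + 1)) ∧
          ∀ q ∈ level (p.1.length + p.2.length + 1) (flipWord p.1, flipWord p.2),
            StableAlikeWord q (p.1.length + p.2.length + 1)) := by
  rw [← stableAlike_iff_level, ← stableAlike_iff_level, normWord_eq, normWord_eq,
    FreeGroup.norm_eq_zero, FreeGroup.norm_eq_zero, mk_flipWord, mk_flipWord]
  -- Any chain length and exponent exceeding both cyclic lengths will do, so the lengths of the
  -- given words can replace them and no ordering of u and v is required.
  have hlen : ∀ L : List (Fin 2 × Bool), cycLen (FreeGroup.mk L) ≤ L.length := by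
    intro L
    have h1 := norm_pow (FreeGroup.mk L) one_ne_zero
    have h2 : (FreeGroup.mk L).norm ≤ L.length := FreeGroup.norm_mk_le
    rw [pow_one] at h1
    omega
  have h1 := hlen p.1
  have h2 := hlen p.2
  constructor
  · intro h
    by_cases hu : FreeGroup.mk p.1 = 1
    · exact .inl ⟨hu, (boundedlyTranslationEquivalent_one_iff h).1 hu⟩
    · have hv := fun hv => hu ((boundedlyTranslationEquivalent_one_iff h).2 hv)
      have key := h.stable_iff hu hv (k := p.1.length + p.2.length + 1) (by omega) (by omega)
      exact .inr ⟨⟨hu, hv⟩, fun W _ c => (key W c).1, fun W _ c => (key W c).2⟩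
  · rintro (⟨hu, hv⟩ | ⟨⟨hu, hv⟩, h3, h4⟩)
    · rw [hu, hv]
      exact ⟨1, one_pos, fun φ => by simp [cycLen_one]⟩
    · exact boundedlyTranslationEquivalent_of_stableAlike hu hv (by omega) (by omega)
        (Nat.succ_ne_zero _) h3 h4

/-! ### Primitive recursiveness of the procedure -/

theorem primrec_genWord (c : Bool) : Primrec (genWord c) :=
  Primrec.list_flatMap .id ((Primrec.dom_finite (genLetter c)).comp .snd).to₂

theorem primrec_flipWord : Primrec flipWord :=
  Primrec.list_map .id ((Primrec.dom_finite
    fun l : Fin 2 × Bool => if l.1 = 1 then (l.1, !l.2) else l).comp .snd).to₂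

theorem primrec_reduce :
    Primrec (FreeGroup.reduce : List (Fin 2 × Bool) → List (Fin 2 × Bool)) := by
  have hc : PrimrecPred fun q : (Fin 2 × Bool) × (Fin 2 × Bool) =>
      q.1.1 = q.2.1 ∧ q.1.2 = !q.2.2 :=
    ⟨fun _ => inferInstance, Primrec.dom_finite _⟩
  have hstep : Primrec₂ fun (_ : List (Fin 2 × Bool))
      (q : (Fin 2 × Bool) × List (Fin 2 × Bool)) =>
      (List.casesOn q.2 [q.1] fun hd tl =>
        if q.1.1 = hd.1 ∧ q.1.2 = !hd.2 then tl else q.1 :: hd :: tl :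
        List (Fin 2 × Bool)) := by
    refine Primrec.list_casesOn (f := fun q : List (Fin 2 × Bool) ×
        ((Fin 2 × Bool) × List (Fin 2 × Bool)) => q.2.2) (g := fun q => [q.2.1])
      (h := fun q r => if q.2.1.1 = r.1.1 ∧ q.2.1.2 = !r.1.2 then r.2 else q.2.1 :: r.1 :: r.2)
      (Primrec.snd.comp .snd) ?_ ?_
    · exact Primrec.list_cons.comp (Primrec.fst.comp .snd) (.const [])
    · have hx : Primrec fun q : (List (Fin 2 × Bool) × ((Fin 2 × Bool) × List (Fin 2 × Bool))) ×
          ((Fin 2 × Bool) × List (Fin 2 × Bool)) => q.1.2.1 :=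
        Primrec.fst.comp (Primrec.snd.comp .fst)
      have hy : Primrec fun q : (List (Fin 2 × Bool) × ((Fin 2 × Bool) × List (Fin 2 × Bool))) ×
          ((Fin 2 × Bool) × List (Fin 2 × Bool)) => q.2.1 := Primrec.fst.comp .snd
      have ht : Primrec fun q : (List (Fin 2 × Bool) × ((Fin 2 × Bool) × List (Fin 2 × Bool))) ×
          ((Fin 2 × Bool) × List (Fin 2 × Bool)) => q.2.2 := Primrec.snd.comp .snd
      exact Primrec.ite (hc.comp (hx.pair hy)) ht
        (Primrec.list_cons.comp hx (Primrec.list_cons.comp hy ht))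
  refine (Primrec.list_foldr .id (.const []) hstep).of_eq fun L => ?_
  induction L with
  | nil => rfl
  | cons x L ih =>
    rw [FreeGroup.reduce.cons, ← ih]
    rfl

theorem primrec_normWord : Primrec normWord := Primrec.list_length.comp primrec_reduce

theorem primrec_cycLenWord : Primrec cycLenWord :=
  Primrec.nat_sub.comp (primrec_normWord.comp (Primrec.list_append.comp .id .id)) primrec_normWord

theorem primrec_stableWord (c : Bool) :
    PrimrecPred fun p : List (Fin 2 × Bool) × ℕ => StableWord p.2 c p.1 := by
  have hit : Primrec₂ fun (k : ℕ) (L : List (Fin 2 × Bool)) => (genWord c)^[k] L :=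
    Primrec.nat_iterate .fst .snd ((primrec_genWord c).comp .snd).to₂
  exact Primrec.eq.comp (primrec_cycLenWord.comp (hit.comp (Primrec.succ.comp .snd) .fst))
    (primrec_cycLenWord.comp (hit.comp .snd .fst))

theorem primrecPred_iff {α : Type*} [Primcodable α] {p q : α → Prop} (hp : PrimrecPred p)
    (hq : PrimrecPred q) : PrimrecPred fun x => (p x ↔ q x) :=
  ((hp.and hq).or (hp.not.and hq.not)).of_eq fun x => by tauto

theorem primrec_stableAlikeWord : PrimrecRel StableAlikeWord := by
  have h1 : Primrec fun p : WordPair × ℕ => (p.1.1, p.2) :=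
    (Primrec.fst.comp .fst).pair .snd
  have h2 : Primrec fun p : WordPair × ℕ => (p.1.2, p.2) :=
    (Primrec.snd.comp .fst).pair .snd
  exact (primrecPred_iff ((primrec_stableWord true).comp h1)
    ((primrec_stableWord true).comp h2)).and
    (primrecPred_iff ((primrec_stableWord false).comp h1) ((primrec_stableWord false).comp h2))

theorem primrec_level : Primrec₂ level := by
  have hpair : ∀ c, Primrec fun p : WordPair => (genWord c p.1, genWord c p.2) := fun c =>
    ((primrec_genWord c).comp .fst).pair ((primrec_genWord c).comp .snd)
  have hs : Primrec successors := Primrec.list_cons.comp (hpair true)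
    (Primrec.list_cons.comp (hpair false) (.const []))
  exact Primrec.nat_iterate .fst (Primrec.list_cons.comp .snd (.const []))
    (Primrec.list_flatMap .snd (hs.comp .snd).to₂).to₂

theorem primrec_boundedlyTranslationEquivalent : PrimrecPred fun p : WordPair =>
    BoundedlyTranslationEquivalent (FreeGroup.mk p.1) (FreeGroup.mk p.2) := by
  have hN : Primrec fun p : WordPair => p.1.length + p.2.length + 1 :=
    Primrec.succ.comp (Primrec.nat_add.comp (Primrec.list_length.comp .fst)
      (Primrec.list_length.comp .snd))
  have h1 : PrimrecPred fun p : WordPair => normWord p.1 = 0 :=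
    Primrec.eq.comp (primrec_normWord.comp .fst) (.const 0)
  have h2 : PrimrecPred fun p : WordPair => normWord p.2 = 0 :=
    Primrec.eq.comp (primrec_normWord.comp .snd) (.const 0)
  have hall := primrec_stableAlikeWord.forall_mem_list
  have hflip : Primrec fun p : WordPair => (flipWord p.1, flipWord p.2) :=
    (primrec_flipWord.comp .fst).pair (primrec_flipWord.comp .snd)
  have h3 := hall.comp (primrec_level.comp hN .id) hN
  have h4 := hall.comp (primrec_level.comp hN hflip) hN
  exact ((h1.and h2).or ((h1.not.and h2.not).and (h3.and h4))).of_eq fun p =>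
    (boundedlyTranslationEquivalent_mk_iff p).symm

end F2

theorem mainTheorem3 :
    (∀ u v : F2, F2.cycLen v ≤ F2.cycLen u →
      F2.BoundedlyTranslationEquivalent u v → F2.ChainCriterion u v) ∧
    (∀ u v : F2, u ≠ 1 → v ≠ 1 → F2.cycLen v ≤ F2.cycLen u →
      F2.ChainCriterion u v → F2.BoundedlyTranslationEquivalent u v) ∧
    (∀ n : ℕ, (F2.chainsC1 n).Finite ∧ (F2.chainsC2 n).Finite) ∧
    ComputablePred (fun p : List (Fin 2 × Bool) × List (Fin 2 × Bool) =>
      F2.BoundedlyTranslationEquivalent (FreeGroup.mk p.1) (FreeGroup.mk p.2)) :=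
  ⟨fun _ _ huv h => F2.chainCriterion_of_boundedlyTranslationEquivalent huv h,
    fun _ _ hu hv huv h => F2.boundedlyTranslationEquivalent_of_chainCriterion hu hv huv h,
    fun n => ⟨F2.chainsC1_finite n, F2.chainsC2_finite n⟩,
    F2.primrec_boundedlyTranslationEquivalent.computablePred⟩
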